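/- Let $n\ge 0$. A $B_n$-partition is a set partition $\pi$ of $\{1,2,\dots,n,-1,-2,\dots,-n\}$ such that for every block $B$ of $\pi$ the set $-B=\{-b: b\in B\}$ is also a block of $\pi$, and such that there is at most one block with $B=-B$ (the zero-block). A block pair of $\pi$ is an unordered pair $\{B,-B\}$, where $B$ is a block of $\pi$ that is not the zero-block. Let $M_n$ be the number of $B_n$-partitions (so $M_0=1$), and let $\xi_n$ be the number of block pairs of a $B_n$-partition chosen uniformly at random, with expectation $E(\xi_n)$ and variance $V(\xi_n)$. Then, for all $n\ge 0$, $$E(\xi_n)=\frac{M_{n+1}}{2M_n}-1,\qquad V(\xi_n)=\frac{M_{n+2}}{4M_n}-\frac{M_{n+1}^2}{4M_n^2}-\frac12,$$ and, as $n\to\infty$, $$E(\xi_n)\sim\frac{n}{\log n},\qquad V(\xi_n)\sim\frac{n}{\log^2 n}.$$ -/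

import Mathlib

open scoped Pointwise

/-- The ground set `{1, …, n, -1, …, -n}`. -/
noncomputable def signedSet (n : ℕ) : Finset ℤ := (Finset.Icc (-(n : ℤ)) (n : ℤ)).erase 0

/-- A set partition of `{±1, …, ±n}` is of type `B_n` if it is closed under `B ↦ -B` (where `-B` is
the pointwise negation) and has at most one zero-block, that is, at most one block with `-B = B`. -/
def IsTypeB {n : ℕ} (π : Finpartition (signedSet n)) : Prop :=
  (∀ B ∈ π.parts, -B ∈ π.parts) ∧
    ∀ B ∈ π.parts, ∀ C ∈ π.parts, -B = B → -C = C → B = C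

/-- The type of `B_n`-partitions. -/
def TypeBPartition (n : ℕ) : Type := {π : Finpartition (signedSet n) // IsTypeB π}

namespace TypeBPartition

instance (n : ℕ) : Finite (TypeBPartition n) :=
  inferInstanceAs (Finite {π : Finpartition (signedSet n) // IsTypeB π})

/-- The partition into singletons is a `B_n`-partition (without zero-block). -/
instance (n : ℕ) : Nonempty (TypeBPartition n) := by
  have key : ∀ B ∈ (⊥ : Finpartition (signedSet n)).parts, ∃ a ∈ signedSet n, B = {a} := by
    intro B hB
    obtain ⟨a, ha, rfl⟩ := Finpartition.mem_bot_iff.1 hB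
    exact ⟨a, ha, rfl⟩
  refine ⟨⟨⊥, ?_, ?_⟩⟩
  · intro B hB
    obtain ⟨a, ha, rfl⟩ := key B hB
    refine Finpartition.mem_bot_iff.2 ⟨-a, ?_, by simp⟩
    simp only [signedSet, Finset.mem_erase, Finset.mem_Icc] at ha ⊢
    omega
  · intro B hB C hC h _
    obtain ⟨a, ha, rfl⟩ := key B hB
    simp only [signedSet, Finset.mem_erase, Finset.mem_Icc] at ha
    simp only [Finset.neg_singleton, Finset.singleton_inj] at h
    omega

/-- Every set of `B_n`-partitions is an event. -/
instance (n : ℕ) : MeasurableSpace (TypeBPartition n) := ⊤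

instance (n : ℕ) : DiscreteMeasurableSpace (TypeBPartition n) := ⟨fun _ => trivial⟩

/-- The block pairs `{B, -B}` of a `B_n`-partition, `B` running over the blocks that are not
the zero-block. -/
def blockPairs {n : ℕ} (π : TypeBPartition n) : Finset (Sym2 (Finset ℤ)) :=
  (π.1.parts.filter fun B => -B ≠ B).image fun B => s(B, -B)

/-- The random variable `ξ_n`: the number of block pairs of a `B_n`-partition. -/
def xi (n : ℕ) (π : TypeBPartition n) : ℝ := (π.blockPairs.card : ℝ)

/-- The uniform probability measure on the set of `B_n`-partitions. -/
noncomputable def unif (n : ℕ) : MeasureTheory.Measure (TypeBPartition n) :=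
  ProbabilityTheory.uniformOn Set.univ

instance (n : ℕ) : MeasureTheory.IsProbabilityMeasure (unif n) :=
  ProbabilityTheory.isProbabilityMeasure_uniformOn Set.finite_univ Set.univ_nonempty

end TypeBPartition

/-- The number `M_n` of `B_n`-partitions. -/
noncomputable def numTypeB (n : ℕ) : ℕ := Nat.card (TypeBPartition n)

/-- The expectation `E(ξ_n)`. -/
noncomputable def meanXi (n : ℕ) : ℝ :=
  ∫ π, TypeBPartition.xi n π ∂(TypeBPartition.unif n)

/-- The variance `V(ξ_n)`. -/
noncomputable def varXi (n : ℕ) : ℝ :=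
  ProbabilityTheory.variance (TypeBPartition.xi n) (TypeBPartition.unif n)

/-! Write b(π) for the number of block pairs. Colour {1, …, n} with a neutral colour and X pairs of
opposite colours, and extend oddly. The classes of equal colour form a B_n-partition, and π arises
from exactly 2^b(π) X(X-1)⋯(X-b(π)+1) colourings, so these numbers add up to (2X+1)^n
(`sum_two_pow_mul_descFactorial`). Integrating over X = k with Poisson weights of mean 1/2 gives a
Dobiński formula: M_n is a constant times ∑ w_n(k), where w_n(k) = (2k+1)^n / (2^k k!). Since
w_{n+1}(k) = (2k+1) w_n(k), M_{n+1} and M_{n+2} are sums over B_n-partitions of polynomials in b(π),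
which yields both exact formulas.

It also follows that mean and variance of ξ_n are those of a random k with weights w_n, each lowered
by 1/2. These are found without Laplace asymptotics. Put s(k) = w_n(k-1)/w_n(k). Summation by parts
gives avg((s-1) f) = avg(Δf) (`avg_invRatio_sub_one_mul`). Let c be the threshold where s crosses 1,
and d the relative increment of s just after it. Near c, s - 1 behaves like d(k-c), so f = k - c
gives d avg((k-c)²) ≲ 1 (`avg_sq_le`). Conversely f = s - 1 gives avg((s-1)²) = avg(Δs) ≲ d
(`avg_invRatio_sub_one_sq_le`), and Cauchy–Schwarz gives avg((k-x)²) ≳ 1/d for every x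
(`one_le_mul_avg_sq`). Hence the variance is asymptotic to 1/d and the mean stays close to c. Taking
logarithms in s ≈ 1 gives c ~ n / log n, and then d ~ n/c² ~ log² n / n. -/

theorem mem_signedSet {n : ℕ} {a : ℤ} :
    a ∈ signedSet n ↔ a ≠ 0 ∧ -(n : ℤ) ≤ a ∧ a ≤ n := by
  simp [signedSet]

theorem neg_mem_signedSet {n : ℕ} {a : ℤ} (h : a ∈ signedSet n) : -a ∈ signedSet n := by
  rw [mem_signedSet] at *
  omega

/-! ### Odd colourings and their kernels -/

/-- The colours: one neutral colour and `2 * X` colours that come in opposite pairs. -/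
abbrev Color (X : ℕ) : Type := Option (Fin X × Bool)

namespace Color

variable {X : ℕ}

/-- The opposite colour; the neutral colour is its own opposite. -/
def opp : Color X → Color X := Option.map fun p => (p.1, !p.2)

@[simp] theorem opp_none : opp (none : Color X) = none := rfl

@[simp] theorem opp_some (i : Fin X) (b : Bool) : opp (some (i, b)) = some (i, !b) := rfl

@[simp] theorem opp_opp (c : Color X) : opp (opp c) = c := by
  rcases c with _ | ⟨i, b⟩ <;> simp

theorem opp_eq_self {c : Color X} : opp c = c ↔ c = none := by
  rcases c with _ | ⟨i, b⟩ <;> simp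

theorem opp_inj {c d : Color X} : opp c = opp d ↔ c = d :=
  ⟨fun h => by rw [← opp_opp c, h, opp_opp], fun h => h ▸ rfl⟩

theorem eq_or_eq_opp {i : Fin X} {b b' : Bool} :
    (some (i, b) : Color X) = some (i, b') ∨ (some (i, b) : Color X) = opp (some (i, b')) := by
  cases b <;> cases b' <;> simp

end Color

open Color

/-- The odd extension to `ℤ` of a colouring of `{1, …, n}`. -/
def oddExt {n X : ℕ} (c : Fin n → Color X) (a : ℤ) : Color X :=
  -- Truncated subtraction sends `0` to index `0`; the value there is junk, hence the hypothesis `a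
  -- ≠ 0` in `oddExt_neg`.
  if h : a.natAbs - 1 < n then
    (if 0 < a then c ⟨a.natAbs - 1, h⟩ else opp (c ⟨a.natAbs - 1, h⟩)) else none

theorem oddExt_neg {n X : ℕ} (c : Fin n → Color X) {a : ℤ} (ha : a ≠ 0) :
    oddExt c (-a) = opp (oddExt c a) := by
  unfold oddExt
  rcases lt_or_gt_of_ne ha with h | h
  · have h1 : ¬ 0 < a := by omega
    have h2 : a < 0 := h
    simp only [Int.natAbs_neg, Left.neg_pos_iff, h1, h2, if_true, if_false]
    split_ifs <;> simp
  · have h2 : ¬ a < 0 := by omega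
    simp only [Int.natAbs_neg, Left.neg_pos_iff, h, h2, if_true, if_false]
    split_ifs <;> simp

theorem oddExt_succ {n X : ℕ} (c : Fin n → Color X) (i : Fin n) :
    oddExt c ((i : ℕ) + 1 : ℤ) = c i := by
  have h1 : ((i : ℕ) + 1 : ℤ).natAbs - 1 = i := by omega
  have h2 : (0 : ℤ) < (i : ℕ) + 1 := by omega
  simp only [oddExt, h1, h2, i.2, dif_pos, if_true]

theorem succ_mem_signedSet {n : ℕ} (i : Fin n) : ((i : ℕ) + 1 : ℤ) ∈ signedSet n := by
  have := i.2
  rw [mem_signedSet]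
  omega

/-- Two odd extensions that agree on positive elements agree. -/
theorem oddExt_eq_of_odd {n X : ℕ} (c : Fin n → Color X) (f : ℤ → Color X)
    (hf : ∀ a ∈ signedSet n, f (-a) = opp (f a))
    (h : ∀ i : Fin n, c i = f ((i : ℕ) + 1 : ℤ)) {a : ℤ} (ha : a ∈ signedSet n) :
    oddExt c a = f a := by
  have key : ∀ b ∈ signedSet n, 0 < b → oddExt c b = f b := by
    intro b hb hpos
    rw [mem_signedSet] at hb
    obtain ⟨k, rfl⟩ : ∃ k : ℕ, b = k + 1 := ⟨(b - 1).toNat, by omega⟩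
    have hk : k < n := by omega
    have := oddExt_succ c ⟨k, hk⟩
    rw [h] at this
    exact this
  rcases lt_or_ge 0 a with h0 | h0
  · exact key a ha h0
  · have hne : a ≠ 0 := (mem_signedSet.1 ha).1
    have h1 := key (-a) (neg_mem_signedSet ha) (by omega)
    rw [oddExt_neg c hne, hf a ha, opp_inj] at h1
    exact h1

namespace TypeBPartition

variable {n X : ℕ}

theorem part_neg (π : TypeBPartition n) {a : ℤ} (ha : a ∈ signedSet n) :
    π.1.part (-a) = -π.1.part a := by
  apply π.1.part_eq_of_mem (π.2.1 _ (π.1.part_mem.2 ha))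
  simpa using π.1.mem_part ha

/-- A colouring has kernel `π` if its odd extension is constant on the blocks of `π` and separates
them. -/
def IsKernel (π : TypeBPartition n) (c : Fin n → Color X) : Prop :=
  ∀ a ∈ signedSet n, ∀ b ∈ signedSet n, b ∈ π.1.part a ↔ oddExt c a = oddExt c b

theorem ext_part {π ρ : TypeBPartition n}
    (h : ∀ a ∈ signedSet n, π.1.part a = ρ.1.part a) : π = ρ := by
  have key : ∀ π ρ : TypeBPartition n, (∀ a ∈ signedSet n, π.1.part a = ρ.1.part a) →
      π.1.parts ⊆ ρ.1.parts := by
    intro π ρ h B hB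
    obtain ⟨a, ha⟩ := π.1.nonempty_of_mem_parts hB
    have haS := π.1.subset hB ha
    rw [← π.1.part_eq_of_mem hB ha, h a haS]
    exact ρ.1.part_mem.2 haS
  apply Subtype.ext
  apply Finpartition.ext
  exact (key π ρ h).antisymm (key ρ π fun a ha => (h a ha).symm)

theorem IsKernel.unique {π ρ : TypeBPartition n} {c : Fin n → Color X} (hπ : IsKernel π c)
    (hρ : IsKernel ρ c) : π = ρ := by
  apply ext_part
  intro a ha
  ext b
  by_cases hb : b ∈ signedSet n
  · rw [hπ a ha b hb, hρ a ha b hb]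
  · exact ⟨fun h => absurd (π.1.part_subset a h) hb, fun h => absurd (ρ.1.part_subset a h) hb⟩

/-- Oddness makes the classes of equal colour stable under negation. A class equal to its negative
contains some `a` and `-a`, so its colour is its own opposite, hence neutral; there is only one such
class. -/
theorem exists_isKernel (c : Fin n → Color X) : ∃ π : TypeBPartition n, IsKernel π c := by
  classical
  set P := Finpartition.ofSetSetoid (Setoid.ker (oddExt c)) (signedSet n) with hP
  have hmem : ∀ {a b : ℤ}, b ∈ P.part a ↔
      a ∈ signedSet n ∧ b ∈ signedSet n ∧ oddExt c a = oddExt c b := by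
    intro a b
    rw [hP, Finpartition.mem_part_ofSetSetoid_iff_rel]
    rfl
  have hneg : ∀ a ∈ signedSet n, P.part (-a) = -P.part a := by
    intro a ha
    ext b
    rw [Finset.mem_neg', hmem, hmem]
    have h0 := (mem_signedSet.1 ha).1
    constructor
    · rintro ⟨_, hb, h⟩
      refine ⟨ha, neg_mem_signedSet hb, ?_⟩
      rw [oddExt_neg c (mem_signedSet.1 hb).1, ← h, oddExt_neg c h0, opp_opp]
    · rintro ⟨_, hb, h⟩
      have hb' := neg_mem_signedSet hb
      rw [neg_neg] at hb'
      refine ⟨neg_mem_signedSet ha, hb', ?_⟩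
      rw [oddExt_neg c h0, h, oddExt_neg c (mem_signedSet.1 hb').1, opp_opp]
  have hrep : ∀ B ∈ P.parts, ∃ a ∈ signedSet n, B = P.part a := by
    intro B hB
    obtain ⟨a, ha⟩ := P.nonempty_of_mem_parts hB
    exact ⟨a, P.subset hB ha, (P.part_eq_of_mem hB ha).symm⟩
  have hzero : ∀ a ∈ signedSet n, -P.part a = P.part a → oddExt c a = none := by
    intro a ha h
    rw [← hneg a ha] at h
    have h1 : -a ∈ P.part a := h ▸ P.mem_part (neg_mem_signedSet ha)
    have h2 := (hmem.1 h1).2.2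
    rw [oddExt_neg c (mem_signedSet.1 ha).1] at h2
    exact opp_eq_self.1 h2.symm
  refine ⟨⟨P, ?_, ?_⟩, ?_⟩
  · intro B hB
    obtain ⟨a, ha, rfl⟩ := hrep B hB
    rw [← hneg a ha]
    exact P.part_mem.2 (neg_mem_signedSet ha)
  · intro B hB C hC hB' hC'
    obtain ⟨a, ha, rfl⟩ := hrep B hB
    obtain ⟨b, hb, rfl⟩ := hrep C hC
    apply P.part_eq_of_mem (P.part_mem.2 hb)
    rw [hmem]
    exact ⟨hb, ha, (hzero b hb hC').trans (hzero a ha hB').symm⟩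
  · intro a ha b hb
    change b ∈ P.part a ↔ _
    rw [hmem]
    simp [ha, hb]

theorem exists_rep (π : TypeBPartition n) (p : π.blockPairs) :
    ∃ a ∈ signedSet n, -π.1.part a ≠ π.1.part a ∧ s(π.1.part a, -π.1.part a) = p.1 := by
  obtain ⟨p, hp⟩ := p
  simp only [blockPairs, Finset.mem_image, Finset.mem_filter] at hp
  obtain ⟨B, ⟨hB, hB'⟩, rfl⟩ := hp
  obtain ⟨a, ha⟩ := π.1.nonempty_of_mem_parts hB
  refine ⟨a, π.1.subset hB ha, ?_⟩
  rw [π.1.part_eq_of_mem hB ha]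
  exact ⟨hB', rfl⟩

/-- An element of a block of a given block pair. -/
noncomputable def rep (π : TypeBPartition n) (p : π.blockPairs) : ℤ := (π.exists_rep p).choose

theorem rep_mem (π : TypeBPartition n) (p : π.blockPairs) : π.rep p ∈ signedSet n :=
  (π.exists_rep p).choose_spec.1

theorem neg_part_rep_ne (π : TypeBPartition n) (p : π.blockPairs) :
    -π.1.part (π.rep p) ≠ π.1.part (π.rep p) :=
  (π.exists_rep p).choose_spec.2.1

theorem mk_part_rep (π : TypeBPartition n) (p : π.blockPairs) :
    s(π.1.part (π.rep p), -π.1.part (π.rep p)) = p.1 :=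
  (π.exists_rep p).choose_spec.2.2

theorem mem_blockPairs (π : TypeBPartition n) {a : ℤ} (ha : a ∈ signedSet n)
    (h : -π.1.part a ≠ π.1.part a) : s(π.1.part a, -π.1.part a) ∈ π.blockPairs := by
  simp only [blockPairs, Finset.mem_image, Finset.mem_filter]
  exact ⟨_, ⟨π.1.part_mem.2 ha, h⟩, rfl⟩

theorem IsKernel.part_eq_iff {π : TypeBPartition n} {c : Fin n → Color X} (h : IsKernel π c)
    {a b : ℤ} (ha : a ∈ signedSet n) (hb : b ∈ signedSet n) :
    π.1.part a = π.1.part b ↔ oddExt c a = oddExt c b := by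
  rw [eq_comm, ← π.1.mem_part_iff_part_eq_part hb ha, h a ha b hb]

theorem IsKernel.eq_none_iff {π : TypeBPartition n} {c : Fin n → Color X} (h : IsKernel π c)
    {a : ℤ} (ha : a ∈ signedSet n) : oddExt c a = none ↔ -π.1.part a = π.1.part a := by
  rw [← part_neg π ha, h.part_eq_iff (neg_mem_signedSet ha) ha,
    oddExt_neg c (mem_signedSet.1 ha).1, opp_eq_self]

/-- The colours of the chosen representatives of the block pairs. -/
noncomputable def repColor (π : TypeBPartition n) (c : {c : Fin n → Color X // IsKernel π c})
    (p : π.blockPairs) : Fin X × Bool :=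
  (oddExt c.1 (π.rep p)).get (Option.isSome_iff_ne_none.2
    (mt (c.2.eq_none_iff (π.rep_mem p)).1 (π.neg_part_rep_ne p)))

theorem some_repColor (π : TypeBPartition n) (c : {c : Fin n → Color X // IsKernel π c})
    (p : π.blockPairs) : (some (π.repColor c p) : Color X) = oddExt c.1 (π.rep p) := by
  simp [repColor]

/-- Colours with the same index are equal or opposite, so the blocks of the two representatives are
equal or negatives of each other. -/
theorem injective_repColor (π : TypeBPartition n) (c : {c : Fin n → Color X // IsKernel π c}) :
    Function.Injective fun p => (π.repColor c p).1 := by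
  intro p q hpq
  have h1 := π.some_repColor c p
  have h2 := π.some_repColor c q
  have h3 : oddExt c.1 (π.rep p) = oddExt c.1 (π.rep q) ∨
      oddExt c.1 (π.rep p) = opp (oddExt c.1 (π.rep q)) := by
    rw [← h1, ← h2, show π.repColor c p = ((π.repColor c q).1, (π.repColor c p).2) from
      Prod.ext hpq rfl]
    exact eq_or_eq_opp
  apply Subtype.ext
  rw [← π.mk_part_rep p, ← π.mk_part_rep q]
  rcases h3 with h | h
  · rw [(c.2.part_eq_iff (π.rep_mem p) (π.rep_mem q)).2 h]
  · rw [← oddExt_neg _ (mem_signedSet.1 (π.rep_mem q)).1,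
      ← c.2.part_eq_iff (π.rep_mem p) (neg_mem_signedSet (π.rep_mem q)),
      part_neg π (π.rep_mem q)] at h
    rw [h, neg_neg, Sym2.eq_swap]

open Classical in
/-- The odd colouring with prescribed colours of the representatives. -/
noncomputable def colorOfRep (π : TypeBPartition n) (ψ : π.blockPairs → Fin X × Bool) (a : ℤ) :
    Color X :=
  if h : s(π.1.part a, -π.1.part a) ∈ π.blockPairs then
    if π.1.part a = π.1.part (π.rep ⟨_, h⟩) then some (ψ ⟨_, h⟩) else opp (some (ψ ⟨_, h⟩))
  else none

theorem part_rep_eq_or (π : TypeBPartition n) {a : ℤ} (p : π.blockPairs)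
    (h : p.1 = s(π.1.part a, -π.1.part a)) :
    π.1.part a = π.1.part (π.rep p) ∨ π.1.part a = -π.1.part (π.rep p) := by
  have := π.mk_part_rep p
  rw [h, Sym2.eq_iff] at this
  rcases this with h | h
  · exact Or.inl h.1.symm
  · exact Or.inr h.2.symm

theorem eq_none_or_of_colorOfRep (π : TypeBPartition n) (ψ : π.blockPairs → Fin X × Bool) {a : ℤ}
    (ha : a ∈ signedSet n) :
    (-π.1.part a = π.1.part a ∧ π.colorOfRep ψ a = none) ∨
    ∃ p, (π.1.part a = π.1.part (π.rep p) ∧ π.colorOfRep ψ a = some (ψ p)) ∨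
      (π.1.part a = -π.1.part (π.rep p) ∧ π.colorOfRep ψ a = opp (some (ψ p))) := by
  by_cases h0 : -π.1.part a = π.1.part a
  · refine Or.inl ⟨h0, ?_⟩
    rw [colorOfRep, dif_neg]
    intro h
    rcases π.part_rep_eq_or ⟨_, h⟩ rfl with h1 | h1
    · rw [h1] at h0
      exact π.neg_part_rep_ne _ h0
    · rw [h1, neg_neg] at h0
      exact π.neg_part_rep_ne _ h0.symm
  · right
    have h := π.mem_blockPairs ha h0
    refine ⟨⟨_, h⟩, ?_⟩
    rcases π.part_rep_eq_or ⟨_, h⟩ rfl with h1 | h1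
    · left
      refine ⟨h1, ?_⟩
      rw [colorOfRep, dif_pos h, if_pos h1]
    · right
      refine ⟨h1, ?_⟩
      rw [colorOfRep, dif_pos h, if_neg]
      intro h2
      exact π.neg_part_rep_ne _ (h1.symm.trans h2)

theorem colorOfRep_congr (π : TypeBPartition n) (ψ : π.blockPairs → Fin X × Bool) {a b : ℤ}
    (h : π.1.part a = π.1.part b) : π.colorOfRep ψ a = π.colorOfRep ψ b := by
  simp only [colorOfRep, h]

theorem colorOfRep_rep (π : TypeBPartition n) (ψ : π.blockPairs → Fin X × Bool)
    (p : π.blockPairs) : π.colorOfRep ψ (π.rep p) = some (ψ p) := by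
  have h : s(π.1.part (π.rep p), -π.1.part (π.rep p)) ∈ π.blockPairs := by
    rw [π.mk_part_rep]
    exact p.2
  have h1 : (⟨_, h⟩ : π.blockPairs) = p := Subtype.ext (π.mk_part_rep p)
  rw [colorOfRep, dif_pos h, h1, if_pos rfl]

theorem colorOfRep_neg (π : TypeBPartition n) (ψ : π.blockPairs → Fin X × Bool) {a : ℤ}
    (ha : a ∈ signedSet n) : π.colorOfRep ψ (-a) = opp (π.colorOfRep ψ a) := by
  rcases π.eq_none_or_of_colorOfRep ψ ha with ⟨h, h'⟩ | ⟨p, ⟨h, h'⟩ | ⟨h, h'⟩⟩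
  · rw [h', opp_none, ← h']
    apply colorOfRep_congr
    rw [part_neg π ha, h]
  · have h1 : s(π.1.part (-a), -π.1.part (-a)) = p.1 := by
      rw [part_neg π ha, neg_neg, Sym2.eq_swap, h, π.mk_part_rep]
    have h2 : s(π.1.part (-a), -π.1.part (-a)) ∈ π.blockPairs := h1 ▸ p.2
    have h3 : (⟨_, h2⟩ : π.blockPairs) = p := Subtype.ext h1
    rw [h', colorOfRep, dif_pos h2, h3, if_neg]
    rw [part_neg π ha, h]
    exact π.neg_part_rep_ne p
  · rw [h', opp_opp, ← π.colorOfRep_rep ψ p]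
    apply colorOfRep_congr
    rw [part_neg π ha, h, neg_neg]

/-- Distinct indices separate the block pairs and the sign separates `B` from `-B`. The neutral
colour occurs only on self-opposite blocks, of which a `B_n`-partition has at most one. -/
theorem colorOfRep_eq_iff (π : TypeBPartition n) {ψ : π.blockPairs → Fin X × Bool}
    (hψ : Function.Injective fun p => (ψ p).1) {a b : ℤ}
    (ha : a ∈ signedSet n) (hb : b ∈ signedSet n) :
    π.colorOfRep ψ a = π.colorOfRep ψ b ↔ π.1.part a = π.1.part b := by
  refine ⟨fun h => ?_, π.colorOfRep_congr ψ⟩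
  have hinj : ∀ {p q : π.blockPairs} {e e' : Bool},
      (some ((ψ p).1, e) : Color X) = some ((ψ q).1, e') → p = q := by
    intro p q e e' h
    apply hψ
    simp only [Option.some.injEq, Prod.mk.injEq] at h
    exact h.1
  rcases π.eq_none_or_of_colorOfRep ψ ha with ⟨ha1, ha2⟩ | ⟨p, ⟨ha1, ha2⟩ | ⟨ha1, ha2⟩⟩ <;>
  rcases π.eq_none_or_of_colorOfRep ψ hb with ⟨hb1, hb2⟩ | ⟨q, ⟨hb1, hb2⟩ | ⟨hb1, hb2⟩⟩ <;>
  rw [ha2, hb2] at h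
  · exact π.2.2 _ (π.1.part_mem.2 ha) _ (π.1.part_mem.2 hb) ha1 hb1
  · simp at h
  · simp [opp] at h
  · simp at h
  · obtain rfl := hinj h
    rw [ha1, hb1]
  · obtain rfl := hinj h
    simp [opp, Prod.ext_iff] at h
  · simp [opp] at h
  · obtain rfl := hinj h
    simp [opp, Prod.ext_iff] at h
  · obtain rfl := hinj h
    rw [ha1, hb1]

/-- The representatives determine everything: the zero-block must be neutral, and the colour of `-B`
is opposite to that of `B`. -/
theorem bijective_repColor (π : TypeBPartition n) :
    Function.Bijective fun c : {c : Fin n → Color X // IsKernel π c} =>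
      (⟨π.repColor c, π.injective_repColor c⟩ :
        {ψ : π.blockPairs → Fin X × Bool // Function.Injective fun p => (ψ p).1}) := by
  constructor
  · intro c d hcd
    have hrep : ∀ p, oddExt c.1 (π.rep p) = oddExt d.1 (π.rep p) := by
      intro p
      rw [← π.some_repColor c, ← π.some_repColor d]
      exact congrArg some (congrFun (congrArg Subtype.val hcd) p)
    have key : ∀ a ∈ signedSet n, oddExt c.1 a = oddExt d.1 a := by
      intro a ha
      by_cases h0 : -π.1.part a = π.1.part a
      · rw [(c.2.eq_none_iff ha).2 h0, (d.2.eq_none_iff ha).2 h0]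
      · set p : π.blockPairs := ⟨_, π.mem_blockPairs ha h0⟩
        rcases π.part_rep_eq_or p rfl with h | h
        · rw [(c.2.part_eq_iff ha (π.rep_mem p)).1 h, (d.2.part_eq_iff ha (π.rep_mem p)).1 h,
            hrep]
        · rw [← part_neg π (π.rep_mem p)] at h
          have hm := neg_mem_signedSet (π.rep_mem p)
          have h1 := (mem_signedSet.1 (π.rep_mem p)).1
          rw [(c.2.part_eq_iff ha hm).1 h, (d.2.part_eq_iff ha hm).1 h, oddExt_neg _ h1,
            oddExt_neg _ h1, hrep]
    apply Subtype.ext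
    funext i
    rw [← oddExt_succ c.1 i, ← oddExt_succ d.1 i]
    exact key _ (succ_mem_signedSet i)
  · rintro ⟨ψ, hψ⟩
    set c : Fin n → Color X := fun i => π.colorOfRep ψ ((i : ℕ) + 1 : ℤ) with hc
    have hext : ∀ a ∈ signedSet n, oddExt c a = π.colorOfRep ψ a := fun a ha =>
      oddExt_eq_of_odd c _ (fun a ha => π.colorOfRep_neg ψ ha) (fun _ => rfl) ha
    have hker : IsKernel π c := by
      intro a ha b hb
      rw [hext a ha, hext b hb, π.colorOfRep_eq_iff hψ ha hb,
        π.1.mem_part_iff_part_eq_part hb ha, eq_comm]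
    refine ⟨⟨c, hker⟩, Subtype.ext (funext fun p => Option.some_injective _ ?_)⟩
    rw [π.some_repColor, hext _ (π.rep_mem p), colorOfRep_rep]

end TypeBPartition

/-- Pairs of an injection and a Boolean function, as functions to the product. -/
def embeddingProdBool (T : Type*) (X : ℕ) :
    {ψ : T → Fin X × Bool // Function.Injective fun p => (ψ p).1} ≃ (T ↪ Fin X) × (T → Bool) where
  toFun ψ := (⟨fun p => (ψ.1 p).1, ψ.2⟩, fun p => (ψ.1 p).2)
  invFun e := ⟨fun p => (e.1 p, e.2 p), e.1.injective⟩
  left_inv _ := rfl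
  right_inv _ := rfl

/-! ### Counting colourings by kernel -/

namespace TypeBPartition

noncomputable instance (n : ℕ) : Fintype (TypeBPartition n) := Fintype.ofFinite _

/-- The falling factorial counts the injective choices of indices for the block pairs, the power of
two the signs at the representatives. -/
theorem card_isKernel {n : ℕ} (X : ℕ) (π : TypeBPartition n) :
    Nat.card {c : Fin n → Color X // IsKernel π c} =
      2 ^ π.blockPairs.card * X.descFactorial π.blockPairs.card := by
  classical
  rw [Nat.card_eq_of_bijective _ π.bijective_repColor,
    Nat.card_congr (embeddingProdBool π.blockPairs X), Nat.card_eq_fintype_card,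
    Fintype.card_prod, Fintype.card_embedding_eq]
  simp [mul_comm]

/-- Counting the colourings of `{1, …, n}` with `2 * X + 1` colours by their kernels. -/
theorem sum_two_pow_mul_descFactorial (n X : ℕ) :
    ∑ π : TypeBPartition n, 2 ^ π.blockPairs.card * X.descFactorial π.blockPairs.card =
      (2 * X + 1) ^ n := by
  classical
  have e : (Σ π : TypeBPartition n, {c : Fin n → Color X // IsKernel π c}) ≃
      (Fin n → Color X) := by
    refine Equiv.ofBijective (fun x => x.2.1) ⟨?_, ?_⟩
    · rintro ⟨π, c, hc⟩ ⟨ρ, d, hd⟩ h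
      obtain rfl : c = d := h
      obtain rfl := hc.unique hd
      rfl
    · intro c
      obtain ⟨π, hπ⟩ := exists_isKernel c
      exact ⟨⟨π, c, hπ⟩, rfl⟩
  have h := Nat.card_congr e
  rw [Nat.card_sigma] at h
  simp only [card_isKernel] at h
  rw [h, Nat.card_eq_fintype_card]
  simp [mul_comm]

end TypeBPartition

/-! ### The Dobiński series and the exact formulas -/

/-- The terms of the Dobiński-type series of `numTypeB n`. -/
noncomputable def dobinskiTerm (n k : ℕ) : ℝ := (2 * k + 1) ^ n / (2 ^ k * k.factorial)

theorem dobinskiTerm_pos (n k : ℕ) : 0 < dobinskiTerm n k := by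
  unfold dobinskiTerm
  positivity

theorem dobinskiTerm_eq_mul (n k : ℕ) :
    dobinskiTerm n k = dobinskiTerm 0 k * (2 * k + 1) ^ n := by
  simp only [dobinskiTerm, pow_zero]
  ring

theorem dobinskiTerm_succ (n k : ℕ) :
    dobinskiTerm (n + 1) k = dobinskiTerm n k * (2 * k + 1) := by
  simp only [dobinskiTerm]
  ring

/-- Functions of at most polynomial growth. -/
def PolyBdd (f : ℕ → ℝ) : Prop := ∃ (p : ℕ) (C : ℝ), ∀ k, |f k| ≤ C * ((k : ℝ) + 1) ^ p

namespace PolyBdd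

variable {f g : ℕ → ℝ}

theorem const (a : ℝ) : PolyBdd fun _ => a := ⟨0, |a|, fun k => by simp⟩

theorem natCast : PolyBdd fun k => (k : ℝ) := ⟨1, 1, fun k => by
  rw [abs_of_nonneg (Nat.cast_nonneg k)]
  linarith⟩

theorem add (hf : PolyBdd f) (hg : PolyBdd g) : PolyBdd fun k => f k + g k := by
  obtain ⟨p, C, hC⟩ := hf
  obtain ⟨q, D, hD⟩ := hg
  refine ⟨p + q, |C| + |D|, fun k => ?_⟩
  have h1 : (1 : ℝ) ≤ (k : ℝ) + 1 := by
    have : (0 : ℝ) ≤ k := Nat.cast_nonneg k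
    linarith
  have hp : ((k : ℝ) + 1) ^ p ≤ ((k : ℝ) + 1) ^ (p + q) := pow_le_pow_right₀ h1 (by omega)
  have hq : ((k : ℝ) + 1) ^ q ≤ ((k : ℝ) + 1) ^ (p + q) := pow_le_pow_right₀ h1 (by omega)
  calc |f k + g k| ≤ |f k| + |g k| := abs_add_le _ _
    _ ≤ C * ((k : ℝ) + 1) ^ p + D * ((k : ℝ) + 1) ^ q := add_le_add (hC k) (hD k)
    _ ≤ |C| * ((k : ℝ) + 1) ^ p + |D| * ((k : ℝ) + 1) ^ q := by
        gcongr <;> exact le_abs_self _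
    _ ≤ |C| * ((k : ℝ) + 1) ^ (p + q) + |D| * ((k : ℝ) + 1) ^ (p + q) := by gcongr
    _ = _ := by ring

theorem mul (hf : PolyBdd f) (hg : PolyBdd g) : PolyBdd fun k => f k * g k := by
  obtain ⟨p, C, hC⟩ := hf
  obtain ⟨q, D, hD⟩ := hg
  refine ⟨p + q, C * D, fun k => ?_⟩
  rw [abs_mul]
  calc |f k| * |g k| ≤ (C * ((k : ℝ) + 1) ^ p) * (D * ((k : ℝ) + 1) ^ q) :=
        mul_le_mul (hC k) (hD k) (abs_nonneg _) ((abs_nonneg _).trans (hC k))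
    _ = _ := by ring

theorem const_mul (a : ℝ) (hf : PolyBdd f) : PolyBdd fun k => a * f k := (const a).mul hf

theorem sub (hf : PolyBdd f) (hg : PolyBdd g) : PolyBdd fun k => f k - g k := by
  simpa [sub_eq_add_neg] using hf.add (hg.const_mul (-1))

theorem pow (hf : PolyBdd f) (p : ℕ) : PolyBdd fun k => f k ^ p := by
  induction p with
  | zero => simpa using const 1
  | succ p ih => simpa [pow_succ] using ih.mul hf

theorem succ (hf : PolyBdd f) : PolyBdd fun k => f (k + 1) := by
  obtain ⟨p, C, hC⟩ := hf
  refine ⟨p, |C| * 2 ^ p, fun k => (hC _).trans ?_⟩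
  have h0 : (0 : ℝ) ≤ k := Nat.cast_nonneg k
  calc C * (((k + 1 : ℕ) : ℝ) + 1) ^ p ≤ |C| * (2 * ((k : ℝ) + 1)) ^ p := by
        push_cast
        gcongr
        · exact le_abs_self C
        · linarith
    _ = _ := by rw [mul_pow]; ring

theorem summable (hf : PolyBdd f) (n : ℕ) : Summable fun k => dobinskiTerm n k * f k := by
  obtain ⟨p, C, hC⟩ := hf
  have h1 : Summable fun k : ℕ => (((k : ℝ) ^ (n + p)) * (1 / 2 : ℝ) ^ k) :=
    summable_pow_mul_geometric_of_norm_lt_one (n + p) (by norm_num)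
  -- The shift produces powers of `k + 1`; the last factor `2` undoes its effect on the geometric
  -- term. The decay of `1 / 2 ^ k` suffices, and `1 / k!` is bounded by `1`.
  have h2 := ((summable_nat_add_iff 1).2 h1).mul_left (|C| * 2 ^ n * 2)
  refine Summable.of_norm_bounded h2 fun k => ?_
  have h0 : (0 : ℝ) ≤ k := Nat.cast_nonneg k
  have hfac : (1 : ℝ) ≤ k.factorial := by exact_mod_cast Nat.succ_le_of_lt k.factorial_pos
  have hw : dobinskiTerm n k ≤ 2 ^ n * ((k : ℝ) + 1) ^ n * (1 / 2) ^ k := by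
    unfold dobinskiTerm
    rw [div_le_iff₀ (by positivity), ← mul_pow]
    calc ((2 : ℝ) * k + 1) ^ n ≤ (2 * ((k : ℝ) + 1)) ^ n := by
          gcongr
          linarith
      _ = (2 * ((k : ℝ) + 1)) ^ n * (1 / 2 * 2) ^ k * 1 := by norm_num
      _ ≤ (2 * ((k : ℝ) + 1)) ^ n * (1 / 2 * 2) ^ k * k.factorial := by gcongr
      _ = _ := by rw [mul_pow (1 / 2 : ℝ) 2 k]; ring
  rw [Real.norm_eq_abs, abs_mul, abs_of_pos (dobinskiTerm_pos n k)]
  calc dobinskiTerm n k * |f k|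
      ≤ (2 ^ n * ((k : ℝ) + 1) ^ n * (1 / 2) ^ k) * (|C| * ((k : ℝ) + 1) ^ p) := by
        gcongr
        exact (hC k).trans (by gcongr; exact le_abs_self C)
    _ = _ := by
        push_cast
        ring

end PolyBdd

theorem summable_dobinskiTerm (n : ℕ) : Summable (dobinskiTerm n) := by
  simpa using (PolyBdd.const 1).summable n

/-- The normalizing constant of the Dobiński-type series. -/
noncomputable def dobinskiConst : ℝ := ∑' k, dobinskiTerm 0 k

theorem dobinskiConst_pos : 0 < dobinskiConst :=
  (summable_dobinskiTerm 0).tsum_pos (fun k => (dobinskiTerm_pos 0 k).le) 0 (dobinskiTerm_pos 0 0)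

/-- After normalization the weights for `n = 0` are the Poisson law of mean `1/2`, whose `j`-th
factorial moment is `2⁻ʲ`. The induction shifts the index, the term at `0` being zero. -/
theorem hasSum_two_pow_mul_descFactorial (j : ℕ) :
    HasSum (fun k => dobinskiTerm 0 k * (2 ^ j * (k.descFactorial j : ℝ))) dobinskiConst := by
  induction j with
  | zero => simpa [dobinskiConst] using (summable_dobinskiTerm 0).hasSum
  | succ j ih =>
    have h : ∀ k : ℕ, dobinskiTerm 0 (k + 1) * (2 ^ (j + 1) * ((k + 1).descFactorial (j + 1) : ℝ)) =
        dobinskiTerm 0 k * (2 ^ j * (k.descFactorial j : ℝ)) := by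
      intro k
      rw [Nat.succ_descFactorial_succ]
      simp only [dobinskiTerm, Nat.factorial_succ]
      push_cast
      field_simp
      ring
    rw [← hasSum_nat_add_iff' 1]
    simpa [h, Nat.zero_descFactorial_succ, -Nat.descFactorial_succ] using ih

/-- Split `2k + 1 = 2(k - j) + (2j + 1)`. -/
theorem two_pow_mul_descFactorial_mul (j k : ℕ) :
    (2 ^ j * (k.descFactorial j : ℝ)) * (2 * k + 1) =
      2 ^ (j + 1) * (k.descFactorial (j + 1) : ℝ) +
        (2 * j + 1) * (2 ^ j * (k.descFactorial j : ℝ)) := by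
  have h : ((k.descFactorial (j + 1) : ℕ) : ℝ) = ((k : ℝ) - j) * k.descFactorial j := by
    rw [Nat.descFactorial_succ]
    rcases le_or_gt j k with h | h
    · push_cast [Nat.cast_sub h]
      ring
    · rw [Nat.descFactorial_eq_zero_iff_lt.2 h]
      simp
  rw [h]
  ring

theorem hasSum_mul_one (j : ℕ) :
    HasSum (fun k => dobinskiTerm 0 k * (2 ^ j * (k.descFactorial j : ℝ)) * (2 * k + 1))
      (dobinskiConst * (2 * j + 2)) := by
  convert (hasSum_two_pow_mul_descFactorial (j + 1)).add
    ((hasSum_two_pow_mul_descFactorial j).mul_left (2 * (j : ℝ) + 1)) using 1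
  · funext k
    rw [mul_assoc, two_pow_mul_descFactorial_mul]
    ring
  · ring

theorem hasSum_mul_two (j : ℕ) :
    HasSum (fun k => dobinskiTerm 0 k * (2 ^ j * (k.descFactorial j : ℝ)) * (2 * k + 1) ^ 2)
      (dobinskiConst * (4 * (j : ℝ) ^ 2 + 8 * j + 6)) := by
  convert (hasSum_mul_one (j + 1)).add ((hasSum_mul_one j).mul_left (2 * (j : ℝ) + 1)) using 1
  · funext k
    have := two_pow_mul_descFactorial_mul j k
    linear_combination dobinskiTerm 0 k * (2 * k + 1) * this
  · push_cast
    ring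

namespace TypeBPartition

theorem sum_cast (n k : ℕ) :
    ∑ π : TypeBPartition n, (2 : ℝ) ^ π.blockPairs.card * (k.descFactorial π.blockPairs.card : ℝ) =
      (2 * k + 1) ^ n := by
  exact_mod_cast sum_two_pow_mul_descFactorial n k

/-- Expand `(2k + 1) ^ n` by kernels and exchange the finite sum over partitions with the series;
only the moments of `g` against falling factorials remain. -/
theorem tsum_dobinskiTerm_mul {n : ℕ} (g : ℕ → ℝ) (c : ℕ → ℝ)
    (h : ∀ j, HasSum (fun k => dobinskiTerm 0 k * (2 ^ j * (k.descFactorial j : ℝ)) * g k)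
      (dobinskiConst * c j)) :
    ∑' k, dobinskiTerm n k * g k =
      dobinskiConst * ∑ π : TypeBPartition n, c π.blockPairs.card := by
  have h1 := hasSum_sum (s := Finset.univ) fun (π : TypeBPartition n) _ => h π.blockPairs.card
  rw [Finset.mul_sum, ← h1.tsum_eq]
  congr 1
  funext k
  rw [dobinskiTerm_eq_mul, ← sum_cast, Finset.mul_sum, Finset.sum_mul]

end TypeBPartition

theorem numTypeB_eq_card (n : ℕ) : numTypeB n = Fintype.card (TypeBPartition n) := by
  rw [numTypeB, Nat.card_eq_fintype_card]

theorem numTypeB_pos (n : ℕ) : (0 : ℝ) < numTypeB n := by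
  rw [numTypeB_eq_card]
  exact_mod_cast Fintype.card_pos

/-- The Dobiński-type formula for the number of `B_n`-partitions. -/
theorem tsum_dobinskiTerm (n : ℕ) : ∑' k, dobinskiTerm n k = dobinskiConst * numTypeB n := by
  have := TypeBPartition.tsum_dobinskiTerm_mul (n := n) (fun _ => 1) (fun _ => 1)
    (by simpa using hasSum_two_pow_mul_descFactorial)
  simpa [numTypeB_eq_card] using this

/-- Combinatorially, `n + 1` joins one of the `2b` nonzero blocks, joins or creates the zero-block,
or becomes a singleton. Here it follows from the factor `2k + 1` between consecutive weights. -/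
theorem numTypeB_succ (n : ℕ) :
    (numTypeB (n + 1) : ℝ) = ∑ π : TypeBPartition n, (2 * (π.blockPairs.card : ℝ) + 2) := by
  apply mul_left_cancel₀ dobinskiConst_pos.ne'
  rw [← tsum_dobinskiTerm,
    ← TypeBPartition.tsum_dobinskiTerm_mul (fun k => 2 * (k : ℝ) + 1)
      (fun j => 2 * (j : ℝ) + 2) hasSum_mul_one]
  simp only [dobinskiTerm_succ]

theorem numTypeB_add_two (n : ℕ) :
    (numTypeB (n + 2) : ℝ) = ∑ π : TypeBPartition n,
      (4 * (π.blockPairs.card : ℝ) ^ 2 + 8 * π.blockPairs.card + 6) := by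
  apply mul_left_cancel₀ dobinskiConst_pos.ne'
  rw [← tsum_dobinskiTerm,
    ← TypeBPartition.tsum_dobinskiTerm_mul (fun k => (2 * (k : ℝ) + 1) ^ 2)
      (fun j => 4 * (j : ℝ) ^ 2 + 8 * j + 6) hasSum_mul_two]
  simp only [dobinskiTerm_succ, pow_two, mul_assoc]

namespace TypeBPartition

theorem integral_unif {n : ℕ} (f : TypeBPartition n → ℝ) :
    ∫ π, f π ∂(unif n) = (∑ π, f π) / numTypeB n := by
  rw [MeasureTheory.integral_fintype .of_finite, Finset.sum_div]
  refine Finset.sum_congr rfl fun π _ => ?_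
  have : (unif n).real {π} = 1 / numTypeB n := by
    rw [unif, MeasureTheory.measureReal_def, ProbabilityTheory.uniformOn_univ,
      MeasureTheory.Measure.count_singleton, numTypeB_eq_card]
    simp
  rw [this, smul_eq_mul]
  ring

end TypeBPartition

theorem meanXi_eq_sum (n : ℕ) :
    meanXi n = (∑ π : TypeBPartition n, (π.blockPairs.card : ℝ)) / numTypeB n :=
  TypeBPartition.integral_unif _

theorem meanXi_eq (n : ℕ) :
    meanXi n = (numTypeB (n + 1) : ℝ) / (2 * (numTypeB n : ℝ)) - 1 := by
  have h := (numTypeB_pos n).ne'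
  have h2 : (numTypeB n : ℝ) = ∑ _π : TypeBPartition n, (1 : ℝ) := by simp [numTypeB_eq_card]
  rw [meanXi_eq_sum, numTypeB_succ, Finset.sum_add_distrib, ← Finset.mul_sum]
  have h3 : ∑ _π : TypeBPartition n, (2 : ℝ) = 2 * numTypeB n := by
    rw [h2, Finset.mul_sum]
    simp
  rw [h3]
  field_simp
  ring

theorem varXi_eq (n : ℕ) :
    varXi n = (numTypeB (n + 2) : ℝ) / (4 * (numTypeB n : ℝ))
      - (numTypeB (n + 1) : ℝ) ^ 2 / (4 * (numTypeB n : ℝ) ^ 2) - 1 / 2 := by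
  have h := (numTypeB_pos n).ne'
  have h1 : varXi n = (∑ π : TypeBPartition n, (π.blockPairs.card : ℝ) ^ 2) / numTypeB n
      - meanXi n ^ 2 := by
    rw [varXi, ProbabilityTheory.variance_eq_sub .of_discrete, ← meanXi,
      TypeBPartition.integral_unif]
    rfl
  have h3 : ∑ _π : TypeBPartition n, (6 : ℝ) = 6 * numTypeB n := by
    simp [numTypeB_eq_card, mul_comm]
  have h4 : ∑ π : TypeBPartition n, (π.blockPairs.card : ℝ) = numTypeB (n + 1) / 2 - numTypeB n := by
    have := meanXi_eq n
    rw [meanXi_eq_sum] at this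
    field_simp at this
    linarith
  have h5 := numTypeB_add_two n
  rw [Finset.sum_add_distrib, Finset.sum_add_distrib, ← Finset.mul_sum, ← Finset.mul_sum, h3,
    h4] at h5
  have h6 : ∑ π : TypeBPartition n, (π.blockPairs.card : ℝ) ^ 2 =
      (numTypeB (n + 2) - 4 * numTypeB (n + 1) + 2 * numTypeB n) / 4 := by linarith
  rw [h1, h6, meanXi_eq]
  field_simp
  ring

/-! ### Averages with respect to the weights -/

/-- The average of `f` for the weights `dobinskiTerm n`. -/
noncomputable def avg (n : ℕ) (f : ℕ → ℝ) : ℝ :=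
  (∑' k, dobinskiTerm n k * f k) / ∑' k, dobinskiTerm n k

theorem tsum_dobinskiTerm_pos (n : ℕ) : 0 < ∑' k, dobinskiTerm n k :=
  (summable_dobinskiTerm n).tsum_pos (fun k => (dobinskiTerm_pos n k).le) 0 (dobinskiTerm_pos n 0)

section avg

variable {n : ℕ} {f g : ℕ → ℝ}

theorem avg_const (n : ℕ) (a : ℝ) : avg n (fun _ => a) = a := by
  rw [avg, tsum_mul_right]
  exact mul_div_cancel_left₀ a (tsum_dobinskiTerm_pos n).ne'

theorem avg_const_mul (n : ℕ) (a : ℝ) (f : ℕ → ℝ) : avg n (fun k => a * f k) = a * avg n f := by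
  simp only [avg, ← mul_div_assoc, ← tsum_mul_left]
  congr 2
  funext k
  ring

theorem avg_add (hf : PolyBdd f) (hg : PolyBdd g) :
    avg n (fun k => f k + g k) = avg n f + avg n g := by
  simp only [avg, ← add_div, ← (hf.summable n).tsum_add (hg.summable n), mul_add]

theorem avg_sub (hf : PolyBdd f) (hg : PolyBdd g) :
    avg n (fun k => f k - g k) = avg n f - avg n g := by
  simp only [avg, ← sub_div, ← (hf.summable n).tsum_sub (hg.summable n), mul_sub]

theorem avg_mono (hf : PolyBdd f) (hg : PolyBdd g) (h : ∀ k, f k ≤ g k) : avg n f ≤ avg n g := by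
  unfold avg
  gcongr
  · exact (tsum_dobinskiTerm_pos n).le
  · exact hf.summable n
  · exact hg.summable n
  · exact (dobinskiTerm_pos n _).le
  · exact h _

theorem avg_nonneg (h : ∀ k, 0 ≤ f k) : 0 ≤ avg n f :=
  div_nonneg (tsum_nonneg fun k => mul_nonneg (dobinskiTerm_pos n k).le (h k))
    (tsum_dobinskiTerm_pos n).le

end avg

/-! ### The ratio of consecutive weights -/

/-- The quotient of consecutive weights `dobinskiTerm n (k - 1) / dobinskiTerm n k`. -/
noncomputable def invRatio (n k : ℕ) : ℝ := 2 * k * ((2 * k - 1) / (2 * k + 1)) ^ n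

theorem invRatio_zero (n : ℕ) : invRatio n 0 = 0 := by simp [invRatio]

theorem invRatio_succ_pos (n k : ℕ) : 0 < invRatio n (k + 1) := by
  unfold invRatio
  have : (0 : ℝ) < 2 * ((k + 1 : ℕ) : ℝ) - 1 := by
    push_cast
    have : (0 : ℝ) ≤ k := Nat.cast_nonneg k
    linarith
  positivity

theorem invRatio_nonneg (n k : ℕ) : 0 ≤ invRatio n k := by
  rcases k with _ | k
  · rw [invRatio_zero]
  · exact (invRatio_succ_pos n k).le

theorem dobinskiTerm_succ_mul_invRatio (n k : ℕ) :
    dobinskiTerm n (k + 1) * invRatio n (k + 1) = dobinskiTerm n k := by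
  have h : (2 : ℝ) * (k + 1) + 1 ≠ 0 := by positivity
  simp only [dobinskiTerm, invRatio, Nat.factorial_succ, div_pow]
  push_cast
  rw [show (2 : ℝ) * (k + 1) - 1 = 2 * k + 1 by ring]
  field_simp
  ring

theorem PolyBdd.invRatio (n : ℕ) : PolyBdd (invRatio n) := by
  refine ⟨1, 2, fun k => ?_⟩
  have h0 : (0 : ℝ) ≤ k := Nat.cast_nonneg k
  have h1 : |((2 : ℝ) * k - 1) / (2 * k + 1)| ≤ 1 := by
    rw [abs_div, div_le_one (by positivity), abs_of_pos (by positivity : (0 : ℝ) < 2 * k + 1),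
      abs_le]
    constructor <;> linarith
  rw [_root_.invRatio, abs_mul, abs_pow, abs_of_nonneg (by positivity : (0 : ℝ) ≤ 2 * k)]
  calc 2 * (k : ℝ) * |((2 : ℝ) * k - 1) / (2 * k + 1)| ^ n ≤ 2 * k * 1 := by
        gcongr
        exact pow_le_one₀ (abs_nonneg _) h1
    _ ≤ 2 * ((k : ℝ) + 1) ^ 1 := by linarith

/-- Summation by parts against the weights. -/
theorem avg_invRatio_mul {n : ℕ} {f : ℕ → ℝ} (hf : PolyBdd f) :
    avg n (fun k => invRatio n k * f k) = avg n (fun k => f (k + 1)) := by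
  unfold avg
  -- The ratio vanishes at `0`, so no boundary term appears.
  rw [(((PolyBdd.invRatio n).mul hf).summable n).tsum_eq_zero_add]
  simp only [invRatio_zero, zero_mul, mul_zero, zero_add, ← mul_assoc,
    dobinskiTerm_succ_mul_invRatio]

/-- The quotient of consecutive values of `invRatio`. -/
noncomputable def growth (n k : ℕ) : ℝ :=
  (1 + 1 / (k : ℝ)) * (1 + 4 / ((2 * k - 1) * (2 * k + 3))) ^ n

theorem invRatio_succ {n k : ℕ} (hk : 1 ≤ k) : invRatio n (k + 1) = growth n k * invRatio n k := by
  have hk' : (1 : ℝ) ≤ k := by exact_mod_cast hk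
  have h1 : (2 : ℝ) * k - 1 ≠ 0 := by linarith
  have h2 : (2 : ℝ) * k + 3 ≠ 0 := by positivity
  have h3 : (2 : ℝ) * k + 1 ≠ 0 := by positivity
  have h4 : (k : ℝ) ≠ 0 := by positivity
  -- This is `(2k + 1)² = (2k - 1)(2k + 3) + 4`.
  have key : (2 * ((k : ℝ) + 1) - 1) / (2 * (k + 1) + 1) =
      (1 + 4 / ((2 * k - 1) * (2 * k + 3))) * ((2 * k - 1) / (2 * k + 1)) := by
    rw [show (2 : ℝ) * (k + 1) + 1 = 2 * k + 3 by ring]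
    field_simp
    ring
  simp only [invRatio, growth]
  push_cast
  rw [key, mul_pow]
  field_simp

theorem growth_anti {n j k : ℕ} (hj : 1 ≤ j) (hjk : j ≤ k) : growth n k ≤ growth n j := by
  have hj' : (1 : ℝ) ≤ j := by exact_mod_cast hj
  have hjk' : (j : ℝ) ≤ k := by exact_mod_cast hjk
  have h1 : (0 : ℝ) < 2 * j - 1 := by linarith
  have h2 : (0 : ℝ) < 2 * k - 1 := by linarith
  unfold growth
  gcongr

theorem one_lt_growth {n k : ℕ} (hk : 1 ≤ k) : 1 < growth n k := by
  have hk' : (1 : ℝ) ≤ k := by exact_mod_cast hk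
  have h2 : (0 : ℝ) < 2 * k - 1 := by linarith
  have h3 : (0 : ℝ) < 1 / (k : ℝ) := by positivity
  have h4 : (1 : ℝ) ≤ (1 + 4 / ((2 * k - 1) * (2 * k + 3))) ^ n :=
    one_le_pow₀ (le_add_of_nonneg_right (by positivity))
  unfold growth
  nlinarith

/-- The mean of `a` and `c` with weights proportional to `k` and `k + 2` is at least `b`, and `x ↦
xⁿ` is increasing and convex on `x ≥ 0`. -/
theorem invRatio_convex (n k : ℕ) :
    invRatio n (k + 1) - invRatio n k ≤ invRatio n (k + 2) - invRatio n (k + 1) := by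
  have h0 : (0 : ℝ) ≤ k := Nat.cast_nonneg k
  set a : ℝ := (2 * k - 1) / (2 * k + 1) with ha
  set b : ℝ := (2 * k + 1) / (2 * k + 3) with hb
  set c : ℝ := (2 * k + 3) / (2 * k + 5) with hc
  have hb0 : 0 ≤ b := by positivity
  have hc0 : 0 ≤ c := by positivity
  have e0 : invRatio n k = 2 * k * a ^ n := rfl
  have e1 : invRatio n (k + 1) = 2 * (k + 1) * b ^ n := by
    simp only [invRatio, hb]
    push_cast
    ring_nf
  have e2 : invRatio n (k + 2) = 2 * (k + 2) * c ^ n := by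
    simp only [invRatio, hc]
    push_cast
    ring_nf
  suffices h : (2 * (k + 1)) * b ^ n ≤ k * a ^ n + (k + 2) * c ^ n by
    rw [e0, e1, e2]
    linarith
  -- For `k = 0` the base `a` is `-1`, outside the range of convexity, but its weight is zero.
  rcases Nat.eq_zero_or_pos k with rfl | hk
  · have hbc : b ≤ c := by
      rw [hb, hc]
      norm_num
    have := pow_le_pow_left₀ hb0 hbc n
    simp only [Nat.cast_zero]
    linarith
  · have hk' : (1 : ℝ) ≤ k := by exact_mod_cast hk
    have ha0 : 0 ≤ a := div_nonneg (by linarith) (by linarith)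
    have hbb : b ≤ (k / (2 * (k + 1))) * a + ((k + 2) / (2 * (k + 1))) * c := by
      rw [ha, hb, hc, ← sub_nonneg]
      have : (k / (2 * (k + 1)) : ℝ) * ((2 * k - 1) / (2 * k + 1)) +
          ((k + 2) / (2 * (k + 1))) * ((2 * k + 3) / (2 * k + 5)) - (2 * k + 1) / (2 * k + 3) =
          4 / ((2 * k + 1) * (2 * k + 3) * (2 * k + 5) * (k + 1)) := by
        field_simp
        ring
      rw [this]
      positivity
    have hconv := (convexOn_pow (𝕜 := ℝ) n).2 (Set.mem_Ici.2 ha0) (Set.mem_Ici.2 hc0)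
      (by positivity : (0 : ℝ) ≤ k / (2 * (k + 1)))
      (by positivity : (0 : ℝ) ≤ (k + 2) / (2 * (k + 1))) (by field_simp; ring)
    simp only [smul_eq_mul] at hconv
    have h2 := (pow_le_pow_left₀ hb0 hbb n).trans hconv
    have h3 := mul_le_mul_of_nonneg_left h2 (by positivity : (0 : ℝ) ≤ 2 * (k + 1))
    refine h3.trans (le_of_eq ?_)
    field_simp

theorem invRatio_diff_mono {n j k : ℕ} (h : j ≤ k) :
    invRatio n (j + 1) - invRatio n j ≤ invRatio n (k + 1) - invRatio n k :=
  monotone_nat_of_le_succ (f := fun k => invRatio n (k + 1) - invRatio n k)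
    (fun k => invRatio_convex n k) h

theorem invRatio_add_ge (n m j : ℕ) :
    invRatio n m + j * (invRatio n (m + 1) - invRatio n m) ≤ invRatio n (m + j) := by
  induction j with
  | zero => simp
  | succ j ih =>
    have := invRatio_diff_mono (n := n) (Nat.le_add_right m j)
    rw [← add_assoc]
    push_cast
    linarith

/-! ### Moment bounds around the threshold -/

section threshold

/-! `c` is the last index with `invRatio n c < 1`. -/

variable {n c : ℕ}

/-- `growth` is decreasing, so each step down from `c` divides the ratio by at least its value at `c
+ 1`. -/
theorem invRatio_mul_pow_le (j : ℕ) (hj : j ≤ c) :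
    invRatio n (c - j) * growth n (c + 1) ^ j ≤ invRatio n c := by
  have hg : 1 < growth n (c + 1) := one_lt_growth (by omega)
  induction j with
  | zero => simp
  | succ j ih =>
    refine le_trans ?_ (ih (by omega))
    rw [pow_succ', ← mul_assoc]
    gcongr
    rcases Nat.eq_zero_or_pos (c - (j + 1)) with h | h
    · rw [h, invRatio_zero, zero_mul]
      exact invRatio_nonneg _ _
    · rw [show c - j = c - (j + 1) + 1 by omega, invRatio_succ h, mul_comm]
      gcongr
      · exact invRatio_nonneg _ _
      · exact growth_anti h (by omega)

theorem invRatio_mul_one_add_le (hc : invRatio n c < 1) {k : ℕ} (hk : k ≤ c) :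
    invRatio n k * (1 + ((c : ℝ) - k) * (growth n (c + 1) - 1)) ≤ 1 := by
  have hg : 1 < growth n (c + 1) := one_lt_growth (by omega)
  have h1 := invRatio_mul_pow_le (n := n) (c - k) (Nat.sub_le c k)
  rw [show c - (c - k) = k by omega] at h1
  have h2 := one_add_mul_le_pow (a := growth n (c + 1) - 1) (by linarith) (c - k)
  rw [Nat.cast_sub hk, add_sub_cancel] at h2
  exact (mul_le_mul_of_nonneg_left h2 (invRatio_nonneg n k)).trans (h1.trans hc.le)

/-- By convexity the ratio stays above the line through its values at `c + 1` and `c + 2`, whose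
slope is at least `growth n (c + 1) - 1`. -/
theorem invRatio_sub_one_ge (hc' : 1 ≤ invRatio n (c + 1)) {k : ℕ} (hk : c < k) :
    (growth n (c + 1) - 1) * ((k : ℝ) - c - 1) ≤ invRatio n k - 1 := by
  have hg : 1 < growth n (c + 1) := one_lt_growth (by omega)
  obtain ⟨j, rfl⟩ : ∃ j, k = c + 1 + j := ⟨k - (c + 1), by omega⟩
  have h1 := invRatio_add_ge n (c + 1) j
  have h2 := invRatio_succ (n := n) (k := c + 1) (by omega)
  have h3 : growth n (c + 1) - 1 ≤ invRatio n (c + 1 + 1) - invRatio n (c + 1) := by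
    rw [h2]
    nlinarith
  have h4 := mul_le_mul_of_nonneg_left h3 (Nat.cast_nonneg (α := ℝ) j)
  push_cast
  nlinarith

/-- With `z = k - c`, the ideal bound `d z² ≤ (s - 1) z` would average to `d · avg z² ≤ 1`. The true
bounds lose `d z` on the right of `c` and, with `u = -z`, `d (1 - s) u²` on the left. Both losses
are split by AM–GM with a free parameter `l`, to be chosen so that the errors are negligible. -/
theorem sq_le_of_threshold (hc : invRatio n c < 1) (hc' : 1 ≤ invRatio n (c + 1)) {l : ℝ}
    (hl : 0 < l) (k : ℕ) :
    (growth n (c + 1) - 1) * ((k : ℝ) - c) ^ 2 ≤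
      (1 + (growth n (c + 1) - 1) * l / 2) * ((invRatio n k - 1) * ((k : ℝ) - c)) +
      (growth n (c + 1) - 1) / (2 * l) * ((invRatio n k - 1) * ((k : ℝ) - c) ^ 3) +
      (growth n (c + 1) - 1) / 2 * (l + ((k : ℝ) - c) ^ 2 / l) := by
  have hg : 0 < growth n (c + 1) - 1 := by
    have := one_lt_growth (n := n) (k := c + 1) (by omega)
    linarith
  set d := growth n (c + 1) - 1 with hd
  set z := (k : ℝ) - c with hz
  rcases le_or_gt k c with hk | hk
  · have hu : 0 ≤ -z := by
      have : (k : ℝ) ≤ c := by exact_mod_cast hk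
      rw [hz]
      linarith
    have h1 := invRatio_mul_one_add_le hc hk
    rw [← hd, show (c : ℝ) - k = -z by rw [hz]; ring] at h1
    set u := -z with hu'
    have hzu : z = -u := by rw [hu']; ring
    set t := 1 - invRatio n k with ht
    have hS : invRatio n k = 1 - t := by rw [ht]; ring
    have h2 : d * u ≤ t * (1 + d * u) := by
      rw [hS] at h1
      linarith
    have ht0 : 0 ≤ t := by
      by_contra! h
      have := mul_neg_of_neg_of_pos h (by positivity : 0 < 1 + d * u)
      have h3 : 0 ≤ d * u := by positivity
      linarith
    have h3 : d / 2 * (l * (t * u) + t * u ^ 3 / l) ≥ d / 2 * (2 * (t * u ^ 2)) := by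
      gcongr
      have : l * (t * u) + t * u ^ 3 / l - 2 * (t * u ^ 2) = t * u * (l - u) ^ 2 / l := by
        field_simp
        ring
      have h4 : 0 ≤ t * u * (l - u) ^ 2 / l := by positivity
      linarith
    have h4 : 0 ≤ d / 2 * (l + u ^ 2 / l) := by positivity
    have h5 := mul_le_mul_of_nonneg_left h2 hu
    rw [hzu, hS]
    have e1 : (1 + d * l / 2) * ((1 - t - 1) * -u) + d / (2 * l) * ((1 - t - 1) * (-u) ^ 3) +
        d / 2 * (l + (-u) ^ 2 / l) = t * u + d / 2 * (l * (t * u) + t * u ^ 3 / l) +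
        d / 2 * (l + u ^ 2 / l) := by
      field_simp
      ring
    rw [e1]
    nlinarith
  · have hz1 : 1 ≤ z := by
      have : (c : ℝ) + 1 ≤ k := by exact_mod_cast hk
      rw [hz]
      linarith
    have h1 := invRatio_sub_one_ge hc' hk
    rw [← hd, ← hz] at h1
    have hS : 0 ≤ invRatio n k - 1 := le_trans (mul_nonneg hg.le (by linarith)) h1
    have h2 : d * l / 2 * ((invRatio n k - 1) * z) ≥ 0 := by positivity
    have h3 : d / (2 * l) * ((invRatio n k - 1) * z ^ 3) ≥ 0 := by positivity
    have h4 : d / 2 * (l + z ^ 2 / l) ≥ d / 2 * (2 * z) := by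
      gcongr
      have : l + z ^ 2 / l - 2 * z = (l - z) ^ 2 / l := by
        field_simp
        ring
      have h4 : 0 ≤ (l - z) ^ 2 / l := by positivity
      linarith
    have h5 := mul_le_mul_of_nonneg_right h1 (by linarith : 0 ≤ z)
    nlinarith

theorem PolyBdd.sub_natCast (c : ℝ) : PolyBdd fun k => (k : ℝ) - c :=
  PolyBdd.natCast.sub (PolyBdd.const c)

theorem avg_invRatio_sub_one_mul {f : ℕ → ℝ} (hf : PolyBdd f) :
    avg n (fun k => (invRatio n k - 1) * f k) = avg n (fun k => f (k + 1) - f k) := by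
  have h : (fun k => (invRatio n k - 1) * f k) = fun k => invRatio n k * f k - f k := by
    funext k
    ring
  rw [h, avg_sub ((PolyBdd.invRatio n).mul hf) hf, avg_invRatio_mul hf, avg_sub hf.succ hf]

/-- An upper bound for the second moment around the threshold. -/
theorem avg_sq_le (hc : invRatio n c < 1) (hc' : 1 ≤ invRatio n (c + 1)) {l : ℝ} (hl : 0 < l) :
    (growth n (c + 1) - 1) * avg n (fun k => ((k : ℝ) - c) ^ 2) ≤
      1 + (growth n (c + 1) - 1) * l +
      (growth n (c + 1) - 1) / (2 * l) * (7 * avg n (fun k => ((k : ℝ) - c) ^ 2) + 1) := by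
  have hg : 0 < growth n (c + 1) - 1 := by
    have := one_lt_growth (n := n) (k := c + 1) (by omega)
    linarith
  set d := growth n (c + 1) - 1 with hd
  set Q := avg n (fun k => ((k : ℝ) - c) ^ 2) with hQ
  have pz := PolyBdd.sub_natCast c
  have ps : PolyBdd fun k => invRatio n k - 1 := (PolyBdd.invRatio n).sub (PolyBdd.const 1)
  have p1 := ps.mul pz
  have p3 := ps.mul (pz.pow 3)
  have p2 : PolyBdd fun k => l + ((k : ℝ) - c) ^ 2 / l := by
    simpa [div_eq_inv_mul] using (PolyBdd.const l).add ((pz.pow 2).const_mul l⁻¹)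
  have h1 : avg n (fun k => (invRatio n k - 1) * ((k : ℝ) - c)) = 1 := by
    rw [avg_invRatio_sub_one_mul pz]
    have : (fun k : ℕ => ((k + 1 : ℕ) : ℝ) - c - ((k : ℝ) - c)) = fun _ => 1 := by
      funext k
      push_cast
      ring
    rw [this, avg_const]
  have h3 : avg n (fun k => (invRatio n k - 1) * ((k : ℝ) - c) ^ 3) ≤ 6 * Q + 1 := by
    rw [avg_invRatio_sub_one_mul (pz.pow 3)]
    have : 6 * Q + 1 = avg n (fun k => 6 * ((k : ℝ) - c) ^ 2 + 1) := by
      rw [avg_add ((pz.pow 2).const_mul 6) (PolyBdd.const 1), avg_const_mul, avg_const]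
    rw [this]
    refine avg_mono ((pz.pow 3).succ.sub (pz.pow 3))
      (((pz.pow 2).const_mul 6).add (PolyBdd.const 1)) fun k => ?_
    -- An integer is at most its square, so `(z + 1)³ - z³ = 3z² + 3z + 1 ≤ 6z² + 1`.
    have hz : (k : ℝ) - c ≤ ((k : ℝ) - c) ^ 2 := by
      have : (k : ℤ) - c ≤ ((k : ℤ) - c) ^ 2 := Int.le_self_sq _
      exact_mod_cast this
    push_cast
    nlinarith
  have h2 : avg n (fun k => l + ((k : ℝ) - c) ^ 2 / l) = l + Q / l := by
    simp only [div_eq_inv_mul]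
    rw [avg_add (PolyBdd.const l) ((pz.pow 2).const_mul l⁻¹), avg_const_mul, avg_const]
  have key := avg_mono (n := n) ((pz.pow 2).const_mul d)
    (((p1.const_mul (1 + d * l / 2)).add (p3.const_mul (d / (2 * l)))).add (p2.const_mul (d / 2)))
    (fun k => sq_le_of_threshold hc hc' hl k)
  rw [avg_add ((p1.const_mul (1 + d * l / 2)).add (p3.const_mul (d / (2 * l))))
    (p2.const_mul (d / 2)), avg_add (p1.const_mul (1 + d * l / 2)) (p3.const_mul (d / (2 * l))),
    avg_const_mul, avg_const_mul, avg_const_mul, avg_const_mul, h1, h2] at key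
  have h4 : d / (2 * l) * avg n (fun k => (invRatio n k - 1) * ((k : ℝ) - c) ^ 3) ≤
      d / (2 * l) * (6 * Q + 1) := by gcongr
  have e : (1 + d * l / 2) * 1 + d / (2 * l) * (6 * Q + 1) + d / 2 * (l + Q / l) =
      1 + d * l + d / (2 * l) * (7 * Q + 1) := by
    field_simp
    ring
  linarith

/-- Beyond `c` the increment is `(growth n k - 1) s(k)` with `growth` decreasing, and AM–GM bounds
`s - 1`. Up to `c`, convexity bounds it by the increment at `c + 1`, and `s(c + 1) ≤ growth n c`
since `s(c) < 1`. -/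
theorem invRatio_diff_le (hc1 : 1 ≤ c) (hc : invRatio n c < 1) {l : ℝ} (hl : 0 < l) (k : ℕ) :
    invRatio n (k + 1) - invRatio n k ≤
      (growth n (c + 1) - 1) * (growth n c + (l + (invRatio n k - 1) ^ 2 / l) / 2) := by
  have hg : 0 < growth n (c + 1) - 1 := by
    have := one_lt_growth (n := n) (k := c + 1) (by omega)
    linarith
  have hg' := one_lt_growth (n := n) hc1
  have hsq : ∀ x : ℝ, x ≤ (l + x ^ 2 / l) / 2 := by
    intro x
    have e : (l + x ^ 2 / l) / 2 - x = (l - x) ^ 2 / (2 * l) := by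
      field_simp
      ring
    have : 0 ≤ (l - x) ^ 2 / (2 * l) := by positivity
    linarith
  rcases le_or_gt (c + 1) k with hk | hk
  · have h1 := invRatio_succ (n := n) (k := k) (by omega)
    have h2 := growth_anti (n := n) (by omega : 1 ≤ c + 1) hk
    calc invRatio n (k + 1) - invRatio n k = (growth n k - 1) * invRatio n k := by rw [h1]; ring
      _ ≤ (growth n (c + 1) - 1) * invRatio n k := by
          gcongr
          exact invRatio_nonneg n k
      _ ≤ _ := by
          gcongr
          linarith [hsq (invRatio n k - 1)]
  · have h1 := invRatio_diff_mono (n := n) hk.le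
    have h2 := invRatio_succ (n := n) (k := c + 1) (by omega)
    have h3 := invRatio_succ (n := n) hc1
    have h4 : invRatio n (c + 1) ≤ growth n c := by
      rw [h3]
      have := invRatio_nonneg n c
      nlinarith
    calc invRatio n (k + 1) - invRatio n k ≤ (growth n (c + 1) - 1) * invRatio n (c + 1) := by
          rw [h2] at h1
          linarith
      _ ≤ _ := by
          gcongr
          have : 0 ≤ (l + (invRatio n k - 1) ^ 2 / l) / 2 := by positivity
          linarith

/-- An upper bound for the variance of `invRatio n`. -/
theorem avg_invRatio_sub_one_sq_le (hc1 : 1 ≤ c) (hc : invRatio n c < 1) {l : ℝ} (hl : 0 < l) :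
    avg n (fun k => (invRatio n k - 1) ^ 2) ≤ (growth n (c + 1) - 1) *
      (growth n c + (l + avg n (fun k => (invRatio n k - 1) ^ 2) / l) / 2) := by
  set v := avg n (fun k => (invRatio n k - 1) ^ 2) with hv
  have ps : PolyBdd fun k => invRatio n k - 1 := (PolyBdd.invRatio n).sub (PolyBdd.const 1)
  -- Summation by parts with `f = s - 1`.
  have h1 : v = avg n (fun k => invRatio n (k + 1) - invRatio n k) := by
    have h := avg_invRatio_sub_one_mul (n := n) ps
    simp only [← pow_two, sub_sub_sub_cancel_right] at h
    exact h
  set d := growth n (c + 1) - 1 with hd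
  have h2 := avg_mono (n := n) (g := fun k => d * (growth n c + l / 2) +
    d / (2 * l) * (invRatio n k - 1) ^ 2)
    ((PolyBdd.invRatio n).succ.sub (PolyBdd.invRatio n))
    ((PolyBdd.const _).add ((ps.pow 2).const_mul _))
    (fun k => (invRatio_diff_le hc1 hc hl k).trans (le_of_eq (by rw [← hd]; field_simp; ring)))
  rw [← h1, avg_add (PolyBdd.const _) ((ps.pow 2).const_mul _), avg_const, avg_const_mul,
    ← hv] at h2
  refine h2.trans (le_of_eq ?_)
  field_simp
  ring

end threshold

/-- A Cramér–Rao type lower bound. -/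
theorem one_le_mul_avg_sq {n : ℕ} (x : ℝ) {b : ℝ} (hb : 0 < b)
    (h : avg n (fun k => (invRatio n k - 1) ^ 2) ≤ b) :
    1 / b ≤ avg n (fun k => ((k : ℝ) - x) ^ 2) := by
  have pz := PolyBdd.sub_natCast x
  have ps : PolyBdd fun k => invRatio n k - 1 := (PolyBdd.invRatio n).sub (PolyBdd.const 1)
  -- Cauchy–Schwarz in expanded form: the cross moment is `1`, and the coefficient `1 / b` is
  -- optimal when the second moment of `s - 1` equals `b`.
  have h0 : 0 ≤ avg n (fun k => ((k : ℝ) - x - 1 / b * (invRatio n k - 1)) ^ 2) :=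
    avg_nonneg fun k => sq_nonneg _
  have h1 : avg n (fun k => (invRatio n k - 1) * ((k : ℝ) - x)) = 1 := by
    rw [avg_invRatio_sub_one_mul pz]
    have : (fun k : ℕ => ((k + 1 : ℕ) : ℝ) - x - ((k : ℝ) - x)) = fun _ => 1 := by
      funext k
      push_cast
      ring
    rw [this, avg_const]
  have e : (fun k : ℕ => ((k : ℝ) - x - 1 / b * (invRatio n k - 1)) ^ 2) = fun k : ℕ =>
      ((k : ℝ) - x) ^ 2 - 2 / b * ((invRatio n k - 1) * ((k : ℝ) - x)) +
        (1 / b) ^ 2 * (invRatio n k - 1) ^ 2 := by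
    funext k
    ring
  rw [e, avg_add ((pz.pow 2).sub ((ps.mul pz).const_mul _)) ((ps.pow 2).const_mul _),
    avg_sub (pz.pow 2) ((ps.mul pz).const_mul _), avg_const_mul, avg_const_mul, h1] at h0
  have h2 : (1 / b) ^ 2 * avg n (fun k => (invRatio n k - 1) ^ 2) ≤ (1 / b) ^ 2 * b := by gcongr
  have e2 : (1 / b) ^ 2 * b = 1 / b := by field_simp
  have e3 : 2 / b = 1 / b + 1 / b := by ring
  linarith
-- Moments of ξ_n as averages
open Filter Topology

theorem avg_eq_numTypeB_succ_div (n : ℕ) :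
    avg n (fun k => 2 * (k : ℝ) + 1) = numTypeB (n + 1) / numTypeB n := by
  simp only [avg, ← dobinskiTerm_succ]
  rw [tsum_dobinskiTerm, tsum_dobinskiTerm]
  exact mul_div_mul_left _ _ dobinskiConst_pos.ne'

theorem avg_eq_numTypeB_add_two_div (n : ℕ) :
    avg n (fun k => (2 * (k : ℝ) + 1) ^ 2) = numTypeB (n + 2) / numTypeB n := by
  simp only [avg, pow_two, ← mul_assoc, ← dobinskiTerm_succ]
  rw [tsum_dobinskiTerm, tsum_dobinskiTerm]
  exact mul_div_mul_left _ _ dobinskiConst_pos.ne'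

theorem meanXi_eq_avg (n : ℕ) : meanXi n = avg n (fun k => (k : ℝ)) - 1 / 2 := by
  have h := avg_eq_numTypeB_succ_div n
  rw [avg_add (PolyBdd.natCast.const_mul 2) (PolyBdd.const 1), avg_const_mul, avg_const] at h
  have h0 := (numTypeB_pos n).ne'
  rw [meanXi_eq, mul_comm 2, ← div_div, ← h]
  ring

theorem avg_sub_sq (n : ℕ) (x : ℝ) : avg n (fun k => ((k : ℝ) - x) ^ 2) =
    avg n (fun k => (k : ℝ) ^ 2) - 2 * x * avg n (fun k => (k : ℝ)) + x ^ 2 := by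
  have e : (fun k : ℕ => ((k : ℝ) - x) ^ 2) = fun k : ℕ =>
      (k : ℝ) ^ 2 - 2 * x * k + x ^ 2 := by
    funext k
    ring
  have p := PolyBdd.natCast
  rw [e, avg_add ((p.pow 2).sub (p.const_mul _)) (PolyBdd.const _),
    avg_sub (p.pow 2) (p.const_mul _), avg_const_mul, avg_const]

theorem varXi_eq_avg (n : ℕ) :
    varXi n = avg n (fun k => ((k : ℝ) - avg n (fun k => (k : ℝ))) ^ 2) - 1 / 2 := by
  have p := PolyBdd.natCast
  have h1 := avg_eq_numTypeB_succ_div n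
  rw [avg_add (p.const_mul 2) (PolyBdd.const 1), avg_const_mul, avg_const] at h1
  have h2 := avg_eq_numTypeB_add_two_div n
  have e : (fun k : ℕ => (2 * (k : ℝ) + 1) ^ 2) = fun k : ℕ =>
      4 * (k : ℝ) ^ 2 + 4 * k + 1 := by
    funext k
    ring
  rw [e, avg_add (((p.pow 2).const_mul _).add (p.const_mul _)) (PolyBdd.const _),
    avg_add ((p.pow 2).const_mul _) (p.const_mul _), avg_const_mul, avg_const_mul, avg_const] at h2
  have h0 := (numTypeB_pos n).ne'
  rw [avg_sub_sq, varXi_eq]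
  have e1 : (numTypeB (n + 2) : ℝ) / (4 * (numTypeB n : ℝ)) =
      (numTypeB (n + 2) : ℝ) / numTypeB n / 4 := by field_simp
  have e2 : (numTypeB (n + 1) : ℝ) ^ 2 / (4 * (numTypeB n : ℝ) ^ 2) =
      ((numTypeB (n + 1) : ℝ) / numTypeB n) ^ 2 / 4 := by field_simp
  rw [e1, e2, ← h1, ← h2]
  ring

/-- The ratio at `1` is `2 / 3ⁿ < 1`, while convexity and the value `0` at `0` force at least linear
growth. -/
theorem exists_threshold {n : ℕ} (hn : 1 ≤ n) :
    ∃ c, 1 ≤ c ∧ invRatio n c < 1 ∧ 1 ≤ invRatio n (c + 1) := by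
  classical
  have h1 : invRatio n 1 < 1 := by
    have : invRatio n 1 = 2 * (1 / 3) ^ n := by
      simp only [invRatio]
      norm_num
    rw [this]
    have h : (1 / 3 : ℝ) ^ n ≤ (1 / 3) ^ 1 := pow_le_pow_of_le_one (by norm_num) (by norm_num) hn
    linarith
  have hex : ∃ k, 1 ≤ invRatio n k := by
    obtain ⟨j, hj⟩ := exists_nat_gt (1 / invRatio n 1)
    have hpos := invRatio_succ_pos n 0
    rw [zero_add] at hpos
    have := invRatio_add_ge n 0 j
    rw [zero_add, invRatio_zero, zero_add, zero_add, sub_zero] at this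
    rw [div_lt_iff₀ hpos] at hj
    exact ⟨j, by linarith⟩
  have hlt : ∀ k, k < Nat.find hex → invRatio n k < 1 := fun k hk =>
    not_le.1 (Nat.find_min hex hk)
  have h2 : 2 ≤ Nat.find hex := by
    rw [Nat.le_find_iff]
    intro k hk h
    have : k = 0 ∨ k = 1 := by omega
    rcases this with rfl | rfl
    · rw [invRatio_zero] at h
      linarith
    · linarith
  refine ⟨Nat.find hex - 1, by omega, hlt _ (by omega), ?_⟩
  rw [Nat.sub_add_cancel (by omega)]
  exact Nat.find_spec hex

/-- The last index with `invRatio n c < 1`. -/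
noncomputable def threshold (n : ℕ) : ℕ :=
  if hn : 1 ≤ n then (exists_threshold hn).choose else 0

theorem threshold_spec {n : ℕ} (hn : 1 ≤ n) : 1 ≤ threshold n ∧ invRatio n (threshold n) < 1 ∧
    1 ≤ invRatio n (threshold n + 1) := by
  rw [threshold, dif_pos hn]
  exact (exists_threshold hn).choose_spec

/-! ### Asymptotics of the threshold -/

theorem log_invRatio {n k : ℕ} (hk : 1 ≤ k) : Real.log (invRatio n k) =
    Real.log (2 * k) - n * Real.log (1 + 2 / (2 * k - 1)) := by
  have hk' : (1 : ℝ) ≤ k := by exact_mod_cast hk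
  have h1 : (0 : ℝ) < 2 * k - 1 := by linarith
  have e : ((2 : ℝ) * k - 1) / (2 * k + 1) = (1 + 2 / (2 * k - 1) : ℝ)⁻¹ := by
    field_simp
    ring
  have h2 : (0 : ℝ) < 1 + 2 / (2 * k - 1) := by positivity
  rw [invRatio, e, Real.log_mul (by positivity) (by positivity), Real.log_pow, Real.log_inv]
  ring

/-- Take logarithms in `s(c + 1) ≥ 1`; the bound `log (1 + x) ≥ 2x / (x + 2)` at `x = 2 / (2c + 1)`
gives exactly `1 / (c + 1)`. -/
theorem le_mul_log_threshold {n : ℕ} (hn : 1 ≤ n) :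
    (n : ℝ) ≤ (threshold n + 1) * Real.log (2 * (threshold n + 1)) := by
  obtain ⟨-, -, h⟩ := threshold_spec hn
  set c := threshold n
  have h1 := Real.log_nonneg h
  rw [log_invRatio (by omega)] at h1
  push_cast at h1
  have h0 : (0 : ℝ) ≤ c := Nat.cast_nonneg c
  have h3 : (0 : ℝ) < 2 * (c + 1) - 1 := by linarith
  have h2 := Real.le_log_one_add_of_nonneg (x := 2 / (2 * (c + 1) - 1)) (by positivity)
  have e : 2 * (2 / (2 * ((c : ℝ) + 1) - 1)) / (2 / (2 * (c + 1) - 1) + 2) = 1 / (c + 1) := by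
    field_simp
    ring
  rw [e] at h2
  have h4 : (n : ℝ) * (1 / (c + 1)) ≤ Real.log (2 * (c + 1)) := by
    have := mul_le_mul_of_nonneg_left h2 (Nat.cast_nonneg (α := ℝ) n)
    linarith
  have h5 := mul_le_mul_of_nonneg_left h4 (by positivity : (0 : ℝ) ≤ c + 1)
  have e2 : ((c : ℝ) + 1) * (n * (1 / (c + 1))) = n := by field_simp
  linarith

/-- Take logarithms in `s(c) < 1` and use `log (1 + x) ≤ x`. -/
theorem mul_log_threshold_le {n : ℕ} (hn : 1 ≤ n) :
    (threshold n - 1 / 2 : ℝ) * Real.log (threshold n) ≤ n := by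
  obtain ⟨hc, h, -⟩ := threshold_spec hn
  set c := threshold n
  obtain ⟨c', hc'⟩ : ∃ c', c = c' + 1 := ⟨c - 1, by omega⟩
  have hpos : 0 < invRatio n c := by
    rw [hc']
    exact invRatio_succ_pos n c'
  have h1 := Real.log_neg hpos h
  rw [log_invRatio hc] at h1
  have hc1 : (1 : ℝ) ≤ c := by exact_mod_cast hc
  have h3 : (0 : ℝ) < 2 * c - 1 := by linarith
  have h2 := Real.log_le_sub_one_of_pos (by positivity : (0 : ℝ) < 1 + 2 / (2 * c - 1))
  have h4 := mul_le_mul_of_nonneg_left h2 (Nat.cast_nonneg (α := ℝ) n)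
  have h5 : Real.log c ≤ Real.log (2 * c) := Real.log_le_log (by linarith) (by linarith)
  have h6 : Real.log c ≤ n * (1 + 2 / (2 * c - 1) - 1) := by linarith
  have h7 := mul_le_mul_of_nonneg_left h6 (by linarith : (0 : ℝ) ≤ c - 1 / 2)
  have e : ((c : ℝ) - 1 / 2) * (n * (1 + 2 / (2 * c - 1) - 1)) = n := by
    have h8 : (2 : ℝ) * c - 1 ≠ 0 := h3.ne'
    rw [add_sub_cancel_left, show (c : ℝ) - 1 / 2 = (2 * c - 1) / 2 by ring]
    field_simp
  linarith

theorem tendsto_threshold : Tendsto threshold atTop atTop := by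
  rw [tendsto_atTop]
  intro K
  filter_upwards [eventually_ge_atTop (2 * (K + 1) ^ 2 + 1)] with n hn
  by_contra! h
  have h1 := le_mul_log_threshold (n := n) (by omega)
  set c := threshold n
  have h0 : (0 : ℝ) ≤ c := Nat.cast_nonneg c
  have h2 : Real.log (2 * (c + 1)) ≤ 2 * (c + 1) - 1 := Real.log_le_sub_one_of_pos (by positivity)
  have h3 : (n : ℝ) ≤ 2 * (c + 1) ^ 2 := by nlinarith
  have h4 : n ≤ 2 * (c + 1) ^ 2 := by exact_mod_cast h3
  have h5 : (c + 1) ^ 2 ≤ (K + 1) ^ 2 := Nat.pow_le_pow_left (by omega) 2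
  omega

theorem tendsto_threshold_real : Tendsto (fun n => (threshold n : ℝ)) atTop atTop :=
  tendsto_natCast_atTop_atTop.comp tendsto_threshold

theorem tendsto_log_threshold : Tendsto (fun n => Real.log (threshold n)) atTop atTop :=
  Real.tendsto_log_atTop.comp tendsto_threshold_real

theorem tendsto_div_threshold_mul_log :
    Tendsto (fun n : ℕ => (n : ℝ) / (threshold n * Real.log (threshold n))) atTop (𝓝 1) := by
  have hinv := tendsto_inv_atTop_zero.comp tendsto_threshold_real
  have hlinv := tendsto_inv_atTop_zero.comp tendsto_log_threshold
  have hlow : Tendsto (fun n => 1 - 1 / 2 * (threshold n : ℝ)⁻¹) atTop (𝓝 1) := by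
    simpa using tendsto_const_nhds.sub (hinv.const_mul (1 / 2 : ℝ))
  have hup : Tendsto (fun n => (1 + (threshold n : ℝ)⁻¹) *
      (1 + Real.log 4 * (Real.log (threshold n))⁻¹)) atTop (𝓝 1) := by
    simpa using ((tendsto_const_nhds (x := (1 : ℝ))).add hinv).mul
      ((tendsto_const_nhds (x := (1 : ℝ))).add (hlinv.const_mul (Real.log 4)))
  refine tendsto_of_tendsto_of_tendsto_of_le_of_le' hlow hup ?_ ?_
  · filter_upwards [eventually_ge_atTop 1, tendsto_log_threshold.eventually_gt_atTop 0,
      tendsto_threshold_real.eventually_gt_atTop 0] with n hn h1 h2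
    rw [le_div_iff₀ (by positivity)]
    refine le_trans (le_of_eq ?_) (mul_log_threshold_le hn)
    field_simp
  · filter_upwards [eventually_ge_atTop 1, tendsto_log_threshold.eventually_gt_atTop 0,
      tendsto_threshold_real.eventually_ge_atTop 1] with n hn h1 h2
    rw [div_le_iff₀ (by positivity)]
    refine (le_mul_log_threshold hn).trans ?_
    have h3 : Real.log (2 * (threshold n + 1)) ≤ Real.log 4 + Real.log (threshold n) := by
      rw [← Real.log_mul (by norm_num) (by positivity)]
      exact Real.log_le_log (by positivity) (by linarith)
    calc ((threshold n : ℝ) + 1) * Real.log (2 * (threshold n + 1)) ≤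
        (threshold n + 1) * (Real.log 4 + Real.log (threshold n)) := by gcongr
      _ = _ := by
        field_simp
        ring

/-- From `n ~ c log c` one gets `log n = log c + log log c + o(1)`. -/
theorem tendsto_log_div_log_threshold :
    Tendsto (fun n : ℕ => Real.log n / Real.log (threshold n)) atTop (𝓝 1) := by
  have h1 : Tendsto (fun n => Real.log (Real.log (threshold n)) / Real.log (threshold n)) atTop
      (𝓝 0) := (Real.isLittleO_log_id_atTop.tendsto_div_nhds_zero).comp tendsto_log_threshold
  have h2 : Tendsto (fun n : ℕ => Real.log ((n : ℝ) / (threshold n * Real.log (threshold n))))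
      atTop (𝓝 0) := by
    have := tendsto_div_threshold_mul_log.log one_ne_zero
    rwa [Real.log_one] at this
  have h3 := h2.div_atTop tendsto_log_threshold
  have h4 := (tendsto_const_nhds (x := (1 : ℝ))).add (h1.add h3)
  simp only [add_zero] at h4
  refine h4.congr' ?_
  filter_upwards [eventually_ge_atTop 1, tendsto_log_threshold.eventually_gt_atTop 0,
      tendsto_threshold_real.eventually_ge_atTop 1] with n hn h1 h2
  have hn' : (n : ℝ) ≠ 0 := by positivity
  rw [Real.log_div hn' (by positivity), Real.log_mul (by positivity) (by positivity)]
  field_simp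
  ring

theorem tendsto_threshold_mul_log_div :
    Tendsto (fun n : ℕ => (threshold n : ℝ) * Real.log n / n) atTop (𝓝 1) := by
  have h := tendsto_log_div_log_threshold.div tendsto_div_threshold_mul_log one_ne_zero
  rw [div_one] at h
  refine h.congr' ?_
  filter_upwards [eventually_ge_atTop 1, tendsto_log_threshold.eventually_gt_atTop 0,
      tendsto_threshold_real.eventually_ge_atTop 1] with n hn h1 h2
  have hn' : (n : ℝ) ≠ 0 := by positivity
  simp only [Pi.div_apply]
  field_simp

theorem tendsto_log_natCast : Tendsto (fun n : ℕ => Real.log n) atTop atTop :=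
  Real.tendsto_log_atTop.comp tendsto_natCast_atTop_atTop

theorem tendsto_log_div_natCast : Tendsto (fun n : ℕ => Real.log n / (n : ℝ)) atTop (𝓝 0) :=
  (Real.isLittleO_log_id_atTop.tendsto_div_nhds_zero).comp tendsto_natCast_atTop_atTop

theorem tendsto_log_sq_div_natCast :
    Tendsto (fun n : ℕ => Real.log n ^ 2 / (n : ℝ)) atTop (𝓝 0) :=
  ((Real.isLittleO_pow_log_id_atTop (n := 2)).tendsto_div_nhds_zero).comp
    tendsto_natCast_atTop_atTop

/-! ### Asymptotics of the slope -/

theorem growth_le {n k : ℕ} (hk : 1 ≤ k) {y : ℝ}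
    (hy : y = 1 / (k : ℝ) + n * (4 / ((2 * k - 1) * (2 * k + 3)))) (h1 : y < 1) :
    growth n k - 1 ≤ y / (1 - y) := by
  have hk' : (1 : ℝ) ≤ k := by exact_mod_cast hk
  have h2 : (0 : ℝ) < 2 * k - 1 := by linarith
  have h3 : growth n k ≤ Real.exp y := by
    rw [growth, hy, Real.exp_add, Real.exp_nat_mul]
    gcongr
    · linarith [Real.add_one_le_exp (1 / (k : ℝ))]
    · linarith [Real.add_one_le_exp (4 / ((2 * (k : ℝ) - 1) * (2 * k + 3)))]
  have h4 := Real.one_sub_le_exp_neg y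
  rw [Real.exp_neg] at h4
  have h5 : Real.exp y ≤ (1 - y)⁻¹ := by
    rw [← inv_inv (Real.exp y)]
    gcongr
  have e : y / (1 - y) = (1 - y)⁻¹ - 1 := by
    have : 1 - y ≠ 0 := by linarith
    field_simp
    ring
  linarith

theorem le_growth {n k : ℕ} (hk : 1 ≤ k) :
    n * (4 / ((2 * (k : ℝ) - 1) * (2 * k + 3))) ≤ growth n k - 1 := by
  have hk' : (1 : ℝ) ≤ k := by exact_mod_cast hk
  have h2 : (0 : ℝ) < 2 * k - 1 := by linarith
  have h3 : (0 : ℝ) ≤ 4 / ((2 * k - 1) * (2 * k + 3)) := by positivity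
  have h4 := one_add_mul_le_pow (by linarith : (-2 : ℝ) ≤ 4 / ((2 * k - 1) * (2 * k + 3))) n
  have h5 : (0 : ℝ) < 1 / (k : ℝ) := by positivity
  have h6 : (1 : ℝ) ≤ (1 + 4 / ((2 * k - 1) * (2 * k + 3))) ^ n := one_le_pow₀ (by linarith)
  unfold growth
  nlinarith

/-- For `κ ~ n / log n` the main term is `n / κ² ~ log² n / n`, and `1 / κ` is smaller by a factor
`log n`. A general `κ` covers both the threshold and its successor. -/
theorem tendsto_growth_sub_one_mul {κ : ℕ → ℕ}
    (hκ : Tendsto (fun n : ℕ => (κ n : ℝ) * Real.log n / n) atTop (𝓝 1))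
    (h1 : ∀ᶠ n in atTop, 1 ≤ κ n) :
    Tendsto (fun n : ℕ => (growth n (κ n) - 1) * (n / Real.log n ^ 2)) atTop (𝓝 1) := by
  have hl := tendsto_log_div_natCast
  have hll := tendsto_inv_atTop_zero.comp tendsto_log_natCast
  have hlow : Tendsto (fun n : ℕ =>
      (n * (4 / ((2 * (κ n : ℝ) - 1) * (2 * κ n + 3)))) * (n / Real.log n ^ 2)) atTop (𝓝 1) := by
    have h := (tendsto_const_nhds (x := (4 : ℝ))).div
      (((hκ.const_mul 2).sub hl).mul ((hκ.const_mul 2).add (hl.const_mul 3))) (by norm_num)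
    rw [show (4 : ℝ) / ((2 * 1 - 0) * (2 * 1 + 3 * 0)) = 1 by norm_num] at h
    refine h.congr' ?_
    filter_upwards [h1, eventually_ge_atTop 1, tendsto_log_natCast.eventually_gt_atTop 0]
      with n hk hn hlog
    have hn' : (n : ℝ) ≠ 0 := by positivity
    have hk' : (1 : ℝ) ≤ κ n := by exact_mod_cast hk
    have h2 : (2 : ℝ) * κ n - 1 ≠ 0 := by linarith
    have e1 : 2 * ((κ n : ℝ) * Real.log n / n) - Real.log n / n =
      (2 * κ n - 1) * (Real.log n / n) := by ring
    have e2 : 2 * ((κ n : ℝ) * Real.log n / n) + 3 * (Real.log n / n) =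
      (2 * κ n + 3) * (Real.log n / n) := by ring
    simp only [Pi.div_apply]
    rw [e1, e2]
    field_simp
  set y : ℕ → ℝ := fun n => 1 / (κ n : ℝ) + n * (4 / ((2 * κ n - 1) * (2 * κ n + 3))) with hy
  have hyN : Tendsto (fun n : ℕ => y n * (n / Real.log n ^ 2)) atTop (𝓝 1) := by
    have h := ((hκ.inv₀ one_ne_zero).mul hll).add hlow
    rw [mul_zero, zero_add] at h
    refine h.congr' ?_
    filter_upwards [h1, eventually_ge_atTop 1, tendsto_log_natCast.eventually_gt_atTop 0]
      with n hk hn hlog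
    have hn' : (n : ℝ) ≠ 0 := by positivity
    have hk' : (κ n : ℝ) ≠ 0 := by positivity
    simp only [hy, Function.comp_apply]
    rw [add_mul]
    congr 1
    field_simp
  have hy0 : Tendsto y atTop (𝓝 0) := by
    have h := hyN.mul tendsto_log_sq_div_natCast
    rw [mul_zero] at h
    refine h.congr' ?_
    filter_upwards [eventually_ge_atTop 1, tendsto_log_natCast.eventually_gt_atTop 0]
      with n hn hlog
    have hn' : (n : ℝ) ≠ 0 := by positivity
    field_simp
  have hup : Tendsto (fun n : ℕ => y n / (1 - y n) * (n / Real.log n ^ 2)) atTop (𝓝 1) := by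
    have h := hyN.div ((tendsto_const_nhds (x := (1 : ℝ))).sub hy0) (by norm_num)
    rw [show (1 : ℝ) / (1 - 0) = 1 by norm_num] at h
    refine h.congr fun n => ?_
    simp only [Pi.div_apply]
    ring
  refine tendsto_of_tendsto_of_tendsto_of_le_of_le' hlow hup ?_ ?_
  · filter_upwards [h1] with n hk
    gcongr
    exact le_growth hk
  · filter_upwards [h1, hy0.eventually_lt_const zero_lt_one] with n hk hlt
    gcongr
    exact growth_le hk rfl hlt

/-- The logarithmic slope of `invRatio n` at the threshold. -/
noncomputable def slope₀ (n : ℕ) : ℝ := growth n (threshold n + 1) - 1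

theorem slope₀_pos (n : ℕ) : 0 < slope₀ n := by
  have := one_lt_growth (n := n) (k := threshold n + 1) (by omega)
  rw [slope₀]
  linarith

theorem tendsto_slope₀_mul :
    Tendsto (fun n : ℕ => slope₀ n * (n / Real.log n ^ 2)) atTop (𝓝 1) := by
  refine tendsto_growth_sub_one_mul (κ := fun n => threshold n + 1) ?_
    (Eventually.of_forall fun n => by omega)
  have h := tendsto_threshold_mul_log_div.add tendsto_log_div_natCast
  rw [add_zero] at h
  refine h.congr fun n => ?_
  push_cast
  ring

theorem tendsto_zero_of_mul {u : ℕ → ℝ}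
    (h : Tendsto (fun n : ℕ => u n * (n / Real.log n ^ 2)) atTop (𝓝 1)) :
    Tendsto u atTop (𝓝 0) := by
  have h' := h.mul tendsto_log_sq_div_natCast
  rw [mul_zero] at h'
  refine h'.congr' ?_
  filter_upwards [eventually_ge_atTop 1, tendsto_log_natCast.eventually_gt_atTop 0]
    with n hn hlog
  have hn' : (n : ℝ) ≠ 0 := by positivity
  field_simp

theorem tendsto_slope₀ : Tendsto slope₀ atTop (𝓝 0) := tendsto_zero_of_mul tendsto_slope₀_mul

theorem tendsto_sqrt_slope₀ : Tendsto (fun n => √(slope₀ n)) atTop (𝓝 0) := by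
  simpa using tendsto_slope₀.sqrt

theorem tendsto_growth_threshold : Tendsto (fun n => growth n (threshold n)) atTop (𝓝 1) := by
  have h := tendsto_zero_of_mul (tendsto_growth_sub_one_mul tendsto_threshold_mul_log_div
    (by filter_upwards [eventually_ge_atTop 1] with n hn using (threshold_spec hn).1))
  simpa using h.add_const 1

theorem exists_slope₀_mul_avg_le : ∃ U : ℕ → ℝ, Tendsto U atTop (𝓝 1) ∧
    ∀ᶠ n in atTop, slope₀ n * avg n (fun k => ((k : ℝ) - threshold n) ^ 2) ≤ U n := by
  have hr := tendsto_sqrt_slope₀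
  have hd := tendsto_slope₀
  refine ⟨fun n => (1 + √(slope₀ n) + √(slope₀ n) / 2 * slope₀ n) / (1 - √(slope₀ n) * (7 / 2)),
    ?_, ?_⟩
  · have h := ((tendsto_const_nhds (x := (1 : ℝ))).add hr |>.add ((hr.div_const 2).mul hd)).div
      ((tendsto_const_nhds (x := (1 : ℝ))).sub (hr.mul_const (7 / 2))) (by norm_num)
    convert h using 1
    · rfl
    · norm_num
  · filter_upwards [eventually_ge_atTop 1,
      hr.eventually_lt_const (by norm_num : (0 : ℝ) < 2 / 7)] with n hn hlt
    obtain ⟨-, h1, h2⟩ := threshold_spec hn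
    have hpos := slope₀_pos n
    set r := √(slope₀ n) with hr'
    have hr0 : 0 < r := Real.sqrt_pos.2 hpos
    have hsq : slope₀ n = r ^ 2 := (Real.sq_sqrt hpos.le).symm
    -- With `l = 1 / √d` both error terms are of order `√d`; the one containing the second moment is
    -- absorbed on the left, which needs `√d < 2/7`.
    have h := avg_sq_le h1 h2 (inv_pos.2 hr0)
    rw [← slope₀] at h
    rw [le_div_iff₀ (by linarith)]
    rw [hsq] at h ⊢
    have e1 : r ^ 2 * r⁻¹ = r := by field_simp
    have e2 : r ^ 2 / (2 * r⁻¹) = r / 2 * r ^ 2 := by field_simp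
    rw [e1, e2] at h
    linarith

theorem exists_le_slope₀_mul_avg : ∃ L : ℕ → ℝ, Tendsto L atTop (𝓝 1) ∧
    ∀ᶠ n in atTop, ∀ x : ℝ, L n ≤ slope₀ n * avg n (fun k => ((k : ℝ) - x) ^ 2) := by
  have hr := tendsto_sqrt_slope₀
  have hg := tendsto_growth_threshold
  refine ⟨fun n => (1 - √(slope₀ n) / 2) / (growth n (threshold n) + √(slope₀ n) / 2), ?_, ?_⟩
  · have h := ((tendsto_const_nhds (x := (1 : ℝ))).sub (hr.div_const 2)).div
      (hg.add (hr.div_const 2)) (by norm_num)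
    convert h using 1
    · rfl
    · norm_num
  · filter_upwards [eventually_ge_atTop 1, hr.eventually_lt_const zero_lt_one] with n hn hlt x
    obtain ⟨h0, h1, -⟩ := threshold_spec hn
    have hpos := slope₀_pos n
    have hgr := one_lt_growth (n := n) h0
    set r := √(slope₀ n) with hr'
    have hr0 : 0 < r := Real.sqrt_pos.2 hpos
    have hsq : slope₀ n = r ^ 2 := (Real.sq_sqrt hpos.le).symm
    -- Here `l = √d` makes the first error `d √d / 2` and the second `v √d / 2`, again absorbed on
    -- the left.
    have h := avg_invRatio_sub_one_sq_le h0 h1 hr0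
    rw [← slope₀] at h
    set v := avg n (fun k => (invRatio n k - 1) ^ 2)
    have h3 : 0 < 1 - r / 2 := by linarith
    have hv : v ≤ slope₀ n * (growth n (threshold n) + r / 2) / (1 - r / 2) := by
      rw [le_div_iff₀ h3]
      rw [hsq] at h ⊢
      have e : r ^ 2 * (growth n (threshold n) + (r + v / r) / 2) =
          r ^ 2 * (growth n (threshold n) + r / 2) + v * (r / 2) := by
        field_simp
        ring
      rw [e] at h
      linarith
    have h4 := one_le_mul_avg_sq x (by positivity) hv
    refine le_trans (le_of_eq ?_) (mul_le_mul_of_nonneg_left h4 hpos.le)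
    field_simp

/-! ### The asymptotics of variance and mean -/

theorem tendsto_varXi : Tendsto (fun n : ℕ => varXi n / (n / Real.log n ^ 2)) atTop (𝓝 1) := by
  obtain ⟨U, hU, hU'⟩ := exists_slope₀_mul_avg_le
  obtain ⟨L, hL, hL'⟩ := exists_le_slope₀_mul_avg
  have h1 : Tendsto (fun n => slope₀ n * (varXi n + 1 / 2)) atTop (𝓝 1) := by
    refine tendsto_of_tendsto_of_tendsto_of_le_of_le' hL hU ?_ ?_
    · filter_upwards [hL'] with n hn
      rw [varXi_eq_avg, sub_add_cancel]
      exact hn _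
    · filter_upwards [hU'] with n hn
      refine le_trans ?_ hn
      -- The second moment is smallest around the mean, so the bound around the threshold applies.
      rw [varXi_eq_avg, sub_add_cancel, avg_sub_sq, avg_sub_sq n (threshold n)]
      have := (slope₀_pos n).le
      refine mul_le_mul_of_nonneg_left ?_ this
      nlinarith [sq_nonneg (avg n (fun k => (k : ℝ)) - threshold n)]
  have h2 := (h1.div tendsto_slope₀_mul one_ne_zero).sub
    (tendsto_log_sq_div_natCast.const_mul (1 / 2))
  simp only [mul_zero, div_one, sub_zero] at h2
  refine h2.congr' ?_
  filter_upwards [eventually_ge_atTop 1, tendsto_log_natCast.eventually_gt_atTop 0]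
    with n hn hlog
  have hn' : (n : ℝ) ≠ 0 := by positivity
  have hs := (slope₀_pos n).ne'
  simp only [Pi.div_apply]
  field_simp
  ring

/-- The squared distance from the mean to the threshold is at most the second moment around the
threshold, which is `O(n / log² n)`, hence `o((n / log n)²)`. -/
theorem tendsto_meanXi : Tendsto (fun n : ℕ => meanXi n / (n / Real.log n)) atTop (𝓝 1) := by
  obtain ⟨U, hU, hU'⟩ := exists_slope₀_mul_avg_le
  set μ : ℕ → ℝ := fun n => avg n (fun k => (k : ℝ)) with hμ
  have h1 : Tendsto (fun n : ℕ => U n / (slope₀ n * (n / Real.log n ^ 2)) * (n : ℝ)⁻¹) atTop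
      (𝓝 0) := by
    simpa using (hU.div tendsto_slope₀_mul one_ne_zero).mul
      (tendsto_inv_atTop_zero.comp (tendsto_natCast_atTop_atTop (R := ℝ)))
  have h2 : Tendsto (fun n : ℕ => ((μ n - threshold n) / (n / Real.log n)) ^ 2) atTop (𝓝 0) := by
    refine squeeze_zero' (Eventually.of_forall fun n => sq_nonneg _) ?_ h1
    filter_upwards [hU', eventually_ge_atTop 1, tendsto_log_natCast.eventually_gt_atTop 0]
      with n hUn hn hlog
    have hn' : (0 : ℝ) < n := by positivity
    have hs := slope₀_pos n
    have h3 : (μ n - threshold n) ^ 2 ≤ avg n (fun k => ((k : ℝ) - threshold n) ^ 2) := by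
      have h4 : 0 ≤ avg n (fun k => ((k : ℝ) - μ n) ^ 2) := avg_nonneg fun k => sq_nonneg _
      rw [avg_sub_sq] at h4 ⊢
      simp only [hμ] at h4 ⊢
      nlinarith
    have h4 := (mul_le_mul_of_nonneg_left h3 hs.le).trans hUn
    have e : U n / (slope₀ n * (n / Real.log n ^ 2)) * (n : ℝ)⁻¹ =
        U n / slope₀ n / (n / Real.log n) ^ 2 := by
      field_simp
    rw [e, div_pow]
    gcongr
    rw [le_div_iff₀ hs]
    linarith
  have h3 : Tendsto (fun n : ℕ => (μ n - threshold n) / (n / Real.log n)) atTop (𝓝 0) := by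
    rw [tendsto_zero_iff_abs_tendsto_zero]
    have := h2.sqrt
    simp only [Real.sqrt_sq_eq_abs, Real.sqrt_zero] at this
    exact this
  have h4 := (tendsto_threshold_mul_log_div.add h3).sub (tendsto_log_div_natCast.const_mul (1 / 2))
  simp only [mul_zero, add_zero, sub_zero] at h4
  refine h4.congr' ?_
  filter_upwards [eventually_ge_atTop 1, tendsto_log_natCast.eventually_gt_atTop 0]
    with n hn hlog
  have hn' : (n : ℝ) ≠ 0 := by positivity
  rw [meanXi_eq_avg]
  simp only [hμ]
  field_simp
  ring

theorem mainTheorem3 :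
    (∀ n : ℕ, meanXi n = (numTypeB (n + 1) : ℝ) / (2 * (numTypeB n : ℝ)) - 1) ∧
    Asymptotics.IsEquivalent Filter.atTop meanXi
      (fun n : ℕ => (n : ℝ) / Real.log (n : ℝ)) ∧
    (∀ n : ℕ, varXi n = (numTypeB (n + 2) : ℝ) / (4 * (numTypeB n : ℝ))
      - (numTypeB (n + 1) : ℝ) ^ 2 / (4 * (numTypeB n : ℝ) ^ 2) - 1 / 2) ∧
    Asymptotics.IsEquivalent Filter.atTop varXi
      (fun n : ℕ => (n : ℝ) / Real.log (n : ℝ) ^ 2) := by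
  refine ⟨meanXi_eq, ?_, varXi_eq, ?_⟩
  · refine (Asymptotics.isEquivalent_iff_tendsto_one ?_).2 tendsto_meanXi
    filter_upwards [eventually_ge_atTop 1, tendsto_log_natCast.eventually_gt_atTop 0]
      with n hn hlog
    positivity
  · refine (Asymptotics.isEquivalent_iff_tendsto_one ?_).2 tendsto_varXi
    filter_upwards [eventually_ge_atTop 1, tendsto_log_natCast.eventually_gt_atTop 0]
      with n hn hlog
    positivity
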